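/- **Setting.** Let $\mathcal I=[c,d]$ with $c<d$, let $\int$ denote integration over $\mathcal I$, and for functions on $\mathcal I$ put $\|f\|=(\int f^2)^{1/2}$; for functions on $\mathcal I^2$ put $|||L|||=(\iint L^2)^{1/2}$. For $p$-vectors $\|\cdot\|$ is the Euclidean norm. Let $X$ be a (jointly measurable) random function on $\mathcal I$ and $Y=a+\int bX+\varepsilon$, where $a$ is a constant, $\int b^2<\infty$, $E\|X\|^4<\infty$, $E(\varepsilon^2)<\infty$, $E(\varepsilon^2\|X\|^2)<\infty$ and $E(\varepsilon\mid X)=0$. Let $(X_1,Y_1),(X_2,Y_2),\ldots$ be independent pairs, all distributed as $(X,Y)$. Write $\mu=EX$ and $K(s,t)=\mathrm{cov}\{X(s),X(t)\}$, and let $K(f)(t)=\int f(s)K(s,t)\,ds$. Let $\phi_1,\phi_2,\ldots$ be a complete orthonormal sequence in $L^2(\mathcal I)$ with $K(\phi_k)=\theta_k\phi_k$, $\theta_1\ge\theta_2\ge\cdots$. For $p\ge1$ let $H=(h_{jk})_{1\le j,k\le p}$ with $h_{jk}=\int K^{j+1}(b)K^k(b)$; let $\lambda=\lambda(p)$ be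 its smallest eigenvalue; let $\gamma=(\gamma_1,\ldots,\gamma_p)$ minimize $$t_p(w)=E\Big\{\int (X-EX)b-\sum_{j=1}^p w_j\int (X-EX)K^j(b)\Big\}^2,$$ and let $g_p(x)=E(Y)+\sum_{j=1}^p\gamma_j\int(x-EX)K^j(b)$. (The minimizer is unique whenever $\lambda(p)>0$.) From the first $n$ pairs let $\bar X,\bar Y$ be the sample means, $\hat K(s,t)=n^{-1}\sum_{i\le n}\{X_i(s)-\bar X(s)\}\{X_i(t)-\bar X(t)\}$, $\widehat K(b)=n^{-1}\sum_{i\le n}(X_i-\bar X)(Y_i-\bar Y)$, and $\widehat{K^{j+1}}(b)(t)=\int\widehat{K^j}(b)(s)\hat K(s,t)\,ds$. Let $\hat\gamma=(\hat\gamma_1,\ldots,\hat\gamma_p)$ minimize $n^{-1}\sum_{i\le n}\{Y_i-\bar Y-\sum_{j\le p}w_j\int(X_i-\bar X)\widehat{K^j}(b)\}^2$ over $w\in\mathbb R^p$, and let $\hat g_p(x)=\bar Y+\sum_{j\le p}\hat\gamma_j\int(x-\bar X)\widehat{K^j}(b)$. (If a minimizer is not unique, any fixed choice is allowed.) Put $$\xi(s,t)=n^{-1/2}\sum_{i\le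 n}(1-E)\{X_i(s)-\mu(s)\}\{X_i(t)-\mu(t)\},\qquad \xi_0(t)=n^{-1/2}\sum_{i\le n}(1-E)\{X_i(t)-\mu(t)\}\{Y_i-E(Y_i)\},$$ $\zeta_j(t)=\int K^j(b)(s)\xi(s,t)\,ds$, and, for $j\ge1$, $\xi_j=K^{j-1}(\xi_0)+\sum_{k=0}^{j-2}K^k(\zeta_{j-k-1})$. For $j\ge0$, $k\ge1$ let $\Delta_{1jk}=\int\{\xi_{j+1}K^k(b)+K^{j+1}(b)\xi_k\}$, and let $\Delta_1=(\Delta_{1jk})_{1\le j,k\le p}$ and $\delta=(\Delta_{101},\ldots,\Delta_{10p})^{T}$. **Theorem.** Suppose that $0<\theta_1<|||K|||<1$ and that each $\theta_j>0$. Let $C>0$ be fixed but arbitrary. Then, as $n\to\infty$, $$\big\|\hat\gamma-\{\gamma+n^{-1/2}H^{-1}(\delta-\Delta_1\gamma)\}\big\|=O_p(n^{-1}\lambda^{-3}),$$ $$\begin{aligned}\hat g_p(x)-g_p(x)={}&\bar Y-EY+n^{-1/2}\sum_{j=1}^p\Big[\{H^{-1}(\delta-\Delta_1\gamma)\}_j\int(x-EX)K^j(b)\\&+\gamma_j\int\{(x-EX)\xi_j-n^{1/2}(\bar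 X-EX)K^j(b)\}\Big]+O_p\big(n^{-1}\lambda^{-1}\|\gamma\|+n^{-1}\lambda^{-3}\big),\end{aligned}$$ uniformly in functions $x$ and integers $p$ for which $\|x\|\le C$, $1\le p\le Cn^{1/2}$ and $n^{1/2}\lambda\to\infty$. The uniformity means: for every sequence $\rho_n\to\infty$ and every $\epsilon>0$ there are $M$ and $N$ such that, for each $n\ge N$ and for each of the two relations, the probability (outer probability, if the event is not measurable) that, for some $p$ with $1\le p\le Cn^{1/2}$ and $n^{1/2}\lambda(p)\ge\rho_n$ (and, in the second relation, some $x$ with $\|x\|\le C$), the absolute value of the left-hand side, respectively of the remainder, exceeds $M$ times the stated rate is at most $\epsilon$. -/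

import Mathlib

open MeasureTheory ProbabilityTheory Filter

-- Lebesgue measure on a subset of the line
attribute [local instance] MeasureTheory.Measure.Subtype.measureSpace

namespace APLS

section Basic

variable {T Ω : Type*} [MeasureSpace T] [MeasurableSpace Ω]

/-- The transformation with kernel `L`: `L(f)(t) = ∫ f(s) L(s,t) ds`. -/
noncomputable def kerOp (L : T → T → ℝ) (f : T → ℝ) : T → ℝ :=
  fun t => ∫ s, f s * L s t

/-- `|||L||| = (∫∫ L²)^{1/2}`. -/
noncomputable def kerNorm (L : T → T → ℝ) : ℝ :=
  √(∫ s, ∫ t, L s t ^ 2)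

/-- A point at which a function on `ℝᵖ` attains its global minimum. Both functions to which this
is applied below are nonnegative quadratic polynomials, so such a point exists. -/
noncomputable def argmin {p : ℕ} (f : (Fin p → ℝ) → ℝ) : Fin p → ℝ :=
  Classical.epsilon fun w => ∀ v, f w ≤ f v

theorem argmin_le {p : ℕ} (f : (Fin p → ℝ) → ℝ) (h : ∃ w, ∀ v, f w ≤ f v) (v : Fin p → ℝ) :
    f (argmin f) ≤ f v :=
  Classical.epsilon_spec h v

/-- The Euclidean norm of a `p`-vector. -/
noncomputable def vecNorm {p : ℕ} (v : Fin p → ℝ) : ℝ :=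
  ‖(WithLp.toLp 2 v : EuclideanSpace ℝ (Fin p))‖

/-- `Z n i = O_p(r n i)` uniformly in `i ∈ S n`, as `n → ∞`. The supremum over `i` is inside the
probability; the set need not be measurable, so `P` is its outer measure there. -/
def IsBigOpUniform {ι : Type*} (P : Measure Ω) (S : ℕ → Set ι) (Z : ℕ → ι → Ω → ℝ)
    (r : ℕ → ι → ℝ) : Prop :=
  ∀ ε : ℝ, 0 < ε → ∃ (M : ℝ) (N : ℕ), ∀ n ≥ N,
    P {ω | ∃ i ∈ S n, M * r n i < |Z n i ω|} ≤ ENNReal.ofReal ε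

end Basic

/-! ### Population quantities, for a random function `X`, a response `Y` and a slope `b` -/

section Population

variable {T Ω : Type*} [MeasureSpace T] [MeasurableSpace Ω]
variable (P : Measure Ω) (X : Ω → T → ℝ) (Y : Ω → ℝ) (b : T → ℝ)

/-- `E(X)`, a function. -/
noncomputable def meanFun : T → ℝ := fun t => ∫ ω, X ω t ∂P

/-- `K(s,t) = cov{X(s), X(t)}`. -/
noncomputable def covFun : T → T → ℝ :=
  fun s t => cov[fun ω => X ω s, fun ω => X ω t; P]

/-- `K^j(b)`. -/
noncomputable def Kpow (j : ℕ) : T → ℝ := (kerOp (covFun P X))^[j] b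

/-- The `p × p` matrix `H` with entries `h_{jk} = ∫ K^{j+1}(b) K^k(b)`, `1 ≤ j, k ≤ p`
(the index `j : Fin p` stands for `j + 1`). -/
noncomputable def Hmat (p : ℕ) : Matrix (Fin p) (Fin p) ℝ :=
  Matrix.of fun j k => ∫ t, Kpow P X b ((j + 1) + 1) t * Kpow P X b (k + 1) t

/-- `λ(p)`, the smallest eigenvalue of `H`. -/
noncomputable def lam (p : ℕ) : ℝ := sInf (spectrum ℝ (Hmat P X b p))

/-- `t_p(w) = E{∫ (X - EX) b - ∑_j w_j ∫ (X - EX) K^j(b)}²`. -/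
noncomputable def tp (p : ℕ) (w : Fin p → ℝ) : ℝ :=
  ∫ ω, ((∫ t, (X ω t - meanFun P X t) * b t)
    - ∑ j, w j * ∫ t, (X ω t - meanFun P X t) * Kpow P X b (j + 1) t) ^ 2 ∂P

/-- `γ = (γ_1, …, γ_p)`, the minimizer of `t_p`. -/
noncomputable def gam (p : ℕ) : Fin p → ℝ := argmin (tp P X b p)

/-- `g_p(x) = E(Y) + ∑_j γ_j ∫ (x - EX) K^j(b)`. -/
noncomputable def gp (p : ℕ) (x : T → ℝ) : ℝ :=
  (∫ ω, Y ω ∂P) + ∑ j, gam P X b p j * ∫ t, (x t - meanFun P X t) * Kpow P X b (j + 1) t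

end Population

/-! ### Empirical quantities, from the first `n` members of the sample `(Xs i, Ys i)` -/

section Empirical

variable {T Ω : Type*} [MeasureSpace T]
variable (Xs : ℕ → Ω → T → ℝ) (Ys : ℕ → Ω → ℝ) (n : ℕ) (ω : Ω)

noncomputable def xBar : T → ℝ := fun t => (n : ℝ)⁻¹ * ∑ i ∈ Finset.range n, Xs i ω t

noncomputable def yBar : ℝ := (n : ℝ)⁻¹ * ∑ i ∈ Finset.range n, Ys i ω

/-- The empirical covariance function. -/
noncomputable def covHat : T → T → ℝ := fun s t =>
  (n : ℝ)⁻¹ * ∑ i ∈ Finset.range n, (Xs i ω s - xBar Xs n ω s) * (Xs i ω t - xBar Xs n ω t)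

/-- The estimator of `K(b)`. -/
noncomputable def KbHat : T → ℝ := fun t =>
  (n : ℝ)⁻¹ * ∑ i ∈ Finset.range n, (Xs i ω t - xBar Xs n ω t) * (Ys i ω - yBar Ys n ω)

/-- The estimator of `K^j(b)`, for `j ≥ 1`: the empirical covariance transformation is applied
`j - 1` times to the estimator of `K(b)`. -/
noncomputable def KpowHat (j : ℕ) : T → ℝ :=
  (kerOp (covHat Xs n ω))^[j - 1] (KbHat Xs Ys n ω)

/-- `U_p(w) = n⁻¹ ∑_i {Y_i - Ȳ - ∑_j w_j ∫ (X_i - X̄) K̂^j(b)}²`. -/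
noncomputable def Up (p : ℕ) (w : Fin p → ℝ) : ℝ :=
  (n : ℝ)⁻¹ * ∑ i ∈ Finset.range n,
    ((Ys i ω - yBar Ys n ω)
      - ∑ j, w j * ∫ t, (Xs i ω t - xBar Xs n ω t) * KpowHat Xs Ys n ω (j + 1) t) ^ 2

/-- The empirical APLS coefficients, the minimizer of `U_p`. -/
noncomputable def gamHat (p : ℕ) : Fin p → ℝ := argmin (Up Xs Ys n ω p)

/-- `ĝ_p(x) = Ȳ + ∑_j γ̂_j ∫ (x - X̄) K̂^j(b)`. -/
noncomputable def gpHat (p : ℕ) (x : T → ℝ) : ℝ :=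
  yBar Ys n ω
    + ∑ j, gamHat Xs Ys n ω p j * ∫ t, (x t - xBar Xs n ω t) * KpowHat Xs Ys n ω (j + 1) t

end Empirical

/-! ### The random functions and matrices of the first-order expansion -/

section Expansion

variable {T Ω : Type*} [MeasureSpace T] [MeasurableSpace Ω]
variable (P : Measure Ω) (X : Ω → T → ℝ) (b : T → ℝ)
variable (Xs : ℕ → Ω → T → ℝ) (Ys : ℕ → Ω → ℝ) (n : ℕ) (ω : Ω)

/-- `ξ(s,t) = n^{-1/2} ∑_i (1 - E) {X_i(s) - μ(s)} {X_i(t) - μ(t)}`, with `μ = E(X)`. -/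
noncomputable def xi : T → T → ℝ := fun s t =>
  (√(n : ℝ))⁻¹ * ∑ i ∈ Finset.range n,
    ((Xs i ω s - meanFun P X s) * (Xs i ω t - meanFun P X t)
      - ∫ ω', (Xs i ω' s - meanFun P X s) * (Xs i ω' t - meanFun P X t) ∂P)

/-- `ξ_0(t) = n^{-1/2} ∑_i (1 - E) {X_i(t) - μ(t)} {Y_i - E(Y_i)}`. -/
noncomputable def xiZero : T → ℝ := fun t =>
  (√(n : ℝ))⁻¹ * ∑ i ∈ Finset.range n,
    ((Xs i ω t - meanFun P X t) * (Ys i ω - ∫ ω', Ys i ω' ∂P)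
      - ∫ ω', (Xs i ω' t - meanFun P X t) * (Ys i ω' - ∫ ω'', Ys i ω'' ∂P) ∂P)

/-- `ζ_j(t) = ∫ K^j(b)(s) ξ(s,t) ds`. -/
noncomputable def zeta (j : ℕ) : T → ℝ := kerOp (xi P X Xs n ω) (Kpow P X b j)

/-- `ξ_j = K^{j-1}(ξ_0) + ∑_{k=0}^{j-2} K^k(ζ_{j-k-1})`, for `j ≥ 1`. -/
noncomputable def xiSeq (j : ℕ) : T → ℝ := fun t =>
  (kerOp (covFun P X))^[j - 1] (xiZero P X Xs Ys n ω) t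
    + ∑ k ∈ Finset.range (j - 1),
        (kerOp (covFun P X))^[k] (zeta P X b Xs n ω (j - k - 1)) t

/-- `Δ_{1jk} = ∫ {ξ_{j+1} K^k(b) + K^{j+1}(b) ξ_k}`, for `j ≥ 0` and `k ≥ 1`. -/
noncomputable def DeltaOneEntry (j k : ℕ) : ℝ :=
  ∫ t, (xiSeq P X b Xs Ys n ω (j + 1) t * Kpow P X b k t
    + Kpow P X b (j + 1) t * xiSeq P X b Xs Ys n ω k t)

/-- The `p × p` matrix `Δ_1 = (Δ_{1jk})`, `1 ≤ j, k ≤ p`. -/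
noncomputable def DeltaOne (p : ℕ) : Matrix (Fin p) (Fin p) ℝ :=
  Matrix.of fun j k => DeltaOneEntry P X b Xs Ys n ω (j + 1) (k + 1)

/-- The vector `δ = (Δ_{101}, …, Δ_{10p})`. -/
noncomputable def deltaVec (p : ℕ) : Fin p → ℝ :=
  fun k => DeltaOneEntry P X b Xs Ys n ω 0 (k + 1)

/-- The vector `H⁻¹ (δ - Δ_1 γ)`. -/
noncomputable def corr (p : ℕ) : Fin p → ℝ :=
  (Hmat P X b p)⁻¹.mulVec
    (deltaVec P X b Xs Ys n ω p - (DeltaOne P X b Xs Ys n ω p).mulVec (gam P X b p))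

/-- The first-order stochastic expansion of `ĝ_p(x) - g_p(x)`:
`Ȳ - EY + n^{-1/2} ∑_j [{H⁻¹(δ - Δ_1 γ)}_j ∫ (x - EX) K^j(b)
  + γ_j ∫ {(x - EX) ξ_j - n^{1/2} (X̄ - EX) K^j(b)}]`. -/
noncomputable def expansion (Y : Ω → ℝ) (p : ℕ) (x : T → ℝ) : ℝ :=
  (yBar Ys n ω - ∫ ω', Y ω' ∂P)
    + (√(n : ℝ))⁻¹ * ∑ j,
      (corr P X b Xs Ys n ω p j * (∫ t, (x t - meanFun P X t) * Kpow P X b (j + 1) t)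
        + gam P X b p j *
          ∫ t, ((x t - meanFun P X t) * xiSeq P X b Xs Ys n ω (j + 1) t
            - √(n : ℝ) * (xBar Xs n ω t - meanFun P X t) * Kpow P X b (j + 1) t))

end Expansion

/-- The integers `p` with `1 ≤ p ≤ C n^{1/2}` and `n^{1/2} λ(p) ≥ ρ n`. -/
def admissible {T Ω : Type*} [MeasureSpace T] [MeasurableSpace Ω] (P : Measure Ω)
    (X : Ω → T → ℝ) (b : T → ℝ) (C : ℝ) (ρ : ℕ → ℝ) (n : ℕ) : Set ℕ :=
  {p | 1 ≤ p ∧ (p : ℝ) ≤ C * √(n : ℝ) ∧ ρ n ≤ √(n : ℝ) * lam P X b p}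

end APLS

/-!
The empirical sequence `K̂^j(b)` is a perturbation of the Krylov sequence `K^j(b)`. With
`s = n^{-1/2}` and `m = X̄ - EX` one has exactly `K̂ = K + s ξ - m ⊗ m` and
`K̂(b) = K(b) + s ξ₀ - (Ȳ - EY) m`; the second identity uses that the covariance function of `X` and
`Y` is `K(b)`, because the error has conditional mean zero. Hence `K̂^j(b) - K^j(b)` and
`K̂^j(b) - K^j(b) - s ξ_j` satisfy linear recursions driven by `K̂` and `K`. As `|||K||| < 1`, and
`K̂` is a contraction too once `s` is small, the `L²` norms of these errors are summable over `j`,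
with sums of orders `s` and `s²` (`KrylovPerturbation.Bounded.exists_sumBounds`). The sums do not
depend on the number of terms; this is where the uniformity in `p` comes from.

Both coefficient vectors solve normal equations: `H γ = α` with `α_k = ∫ K(b) K^k(b)`, and the same
with hats. The matrix `H` is bounded below by `λ`, and its perturbation is of order `s`, below
`λ / 2` when `n^{1/2} λ` is large. Expanding `Ĥ γ̂ = α̂` to first order leaves an error of order
`s² λ^{-3}`, one factor `λ⁻¹` being due to the bound `‖γ‖ = O(λ⁻¹)`
(`KrylovPerturbation.SumBounds.coefficients`); the expansion of the predictor follows by linearity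
(`KrylovPerturbation.SumBounds.prediction`).

The only probabilistic input is that `|||ξ|||`, `‖ξ₀‖`, `n^{1/2} ‖X̄ - EX‖` and `n^{1/2} |Ȳ - EY|`
are bounded in probability (`exists_goodSample`), by Markov's inequality for their second moments.
Equality in law and independence refer to the product σ-algebra on functions, for which integrals
over the interval are not measurable; so the second moments are computed at each point of the
interval, or of its square, and then integrated by Tonelli's theorem.
-/

namespace APLS

/-! ### Vectors, coercive matrices and quadratic minimization -/

section LinearAlgebra

open Matrix

variable {p : ℕ}

theorem vecNorm_nonneg (v : Fin p → ℝ) : 0 ≤ vecNorm v := norm_nonneg _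

theorem vecNorm_sub_le (v w : Fin p → ℝ) : vecNorm (v - w) ≤ vecNorm v + vecNorm w :=
  norm_sub_le _ _

theorem vecNorm_sq (v : Fin p → ℝ) : vecNorm v ^ 2 = v ⬝ᵥ v := by
  rw [vecNorm, EuclideanSpace.norm_sq_eq]
  simp [dotProduct, pow_two]

theorem eq_of_vecNorm_sub_eq_zero {v w : Fin p → ℝ} (h : vecNorm (v - w) = 0) : v = w := by
  have h2 := vecNorm_sq (v - w)
  rw [h] at h2
  have h3 : v - w = 0 := dotProduct_self_eq_zero.1 (by rw [← h2]; norm_num)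
  exact sub_eq_zero.1 h3

theorem abs_apply_le_vecNorm (v : Fin p → ℝ) (i : Fin p) : |v i| ≤ vecNorm v := by
  simpa [vecNorm] using PiLp.norm_apply_le (WithLp.toLp 2 v : EuclideanSpace ℝ (Fin p)) i

theorem abs_dotProduct_le (v w : Fin p → ℝ) : |v ⬝ᵥ w| ≤ vecNorm v * vecNorm w := by
  have h := abs_real_inner_le_norm (WithLp.toLp 2 w : EuclideanSpace ℝ (Fin p))
    (WithLp.toLp 2 v : EuclideanSpace ℝ (Fin p))
  rw [EuclideanSpace.inner_toLp_toLp] at h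
  simpa [vecNorm, mul_comm] using h

theorem abs_sum_mul_le_vecNorm_mul_sum (v w : Fin p → ℝ) :
    |∑ j, v j * w j| ≤ vecNorm v * ∑ j, |w j| := by
  calc |∑ j, v j * w j| ≤ ∑ j, |v j * w j| := Finset.abs_sum_le_sum_abs _ _
    _ ≤ ∑ j, vecNorm v * |w j| := by
        refine Finset.sum_le_sum fun j _ => ?_
        rw [abs_mul]
        exact mul_le_mul_of_nonneg_right (abs_apply_le_vecNorm v j) (abs_nonneg _)
    _ = _ := by rw [Finset.mul_sum]

theorem vecNorm_le_sum_abs (v : Fin p → ℝ) : vecNorm v ≤ ∑ j, |v j| := by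
  have h1 : vecNorm v ^ 2 ≤ vecNorm v * ∑ j, |v j| := by
    rw [vecNorm_sq]
    exact (le_abs_self _).trans (abs_sum_mul_le_vecNorm_mul_sum v v)
  rcases (vecNorm_nonneg v).eq_or_lt with h | h
  · rw [← h]
    positivity
  · nlinarith

theorem vecNorm_mulVec_le (M : Matrix (Fin p) (Fin p) ℝ) (v : Fin p → ℝ) :
    vecNorm (M *ᵥ v) ≤ (∑ j, ∑ k, |M j k|) * vecNorm v := by
  refine (vecNorm_le_sum_abs _).trans ?_
  rw [Finset.sum_mul]
  refine Finset.sum_le_sum fun j _ => ?_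
  have := abs_sum_mul_le_vecNorm_mul_sum v (M j)
  rw [mul_comm]
  refine le_trans (le_of_eq ?_) this
  simp [mulVec, dotProduct, mul_comm]

/-- `H` is bounded below by `l` as a quadratic form. Symmetry of `H` and positivity of `l` are not
part of the notion. -/
def Coercive (H : Matrix (Fin p) (Fin p) ℝ) (l : ℝ) : Prop :=
  ∀ w : Fin p → ℝ, l * vecNorm w ^ 2 ≤ w ⬝ᵥ H *ᵥ w

theorem Coercive.mul_vecNorm_le {H : Matrix (Fin p) (Fin p) ℝ} {l : ℝ} (hH : Coercive H l)
    (w : Fin p → ℝ) : l * vecNorm w ≤ vecNorm (H *ᵥ w) := by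
  have h := (hH w).trans ((le_abs_self _).trans (abs_dotProduct_le w (H *ᵥ w)))
  rcases (vecNorm_nonneg w).eq_or_lt with h0 | h0
  · rw [← h0]
    simpa using vecNorm_nonneg (H *ᵥ w)
  · nlinarith

theorem Coercive.isUnit_det {H : Matrix (Fin p) (Fin p) ℝ} {l : ℝ} (hl : 0 < l)
    (hH : Coercive H l) : IsUnit H.det := by
  rw [← Matrix.isUnit_iff_isUnit_det, ← Matrix.mulVec_injective_iff_isUnit]
  intro v w hvw
  apply eq_of_vecNorm_sub_eq_zero
  have h := hH.mul_vecNorm_le (v - w)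
  have h0 : H *ᵥ (v - w) = 0 := by rw [mulVec_sub]; exact sub_eq_zero.2 hvw
  have h1 : vecNorm (0 : Fin p → ℝ) = 0 := by simp [vecNorm]
  rw [h0, h1] at h
  nlinarith [vecNorm_nonneg (v - w)]

/-- A perturbation smaller than half the lower bound of a form leaves half of that bound. -/
theorem Coercive.perturb {H D : Matrix (Fin p) (Fin p) ℝ} {l : ℝ} (hH : Coercive H l)
    (hD : ∑ j, ∑ k, |D j k| ≤ l / 2) : Coercive (H + D) (l / 2) := by
  intro w
  have h1 : |w ⬝ᵥ D *ᵥ w| ≤ (l / 2) * vecNorm w ^ 2 := by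
    refine (abs_dotProduct_le _ _).trans ?_
    have := (vecNorm_mulVec_le D w).trans (mul_le_mul_of_nonneg_right hD (vecNorm_nonneg w))
    nlinarith [vecNorm_nonneg w]
  have h2 := hH w
  have h3 := neg_abs_le (w ⬝ᵥ D *ᵥ w)
  rw [add_mulVec, dotProduct_add]
  linarith

/-- The minimizer of a strictly convex quadratic polynomial solves its normal equations. -/
theorem mulVec_argmin {f : (Fin p → ℝ) → ℝ} {H : Matrix (Fin p) (Fin p) ℝ} {α : Fin p → ℝ}
    {c l : ℝ} (hl : 0 < l) (hsym : Hᵀ = H) (hH : Coercive H l)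
    (hf : ∀ w, f w = c - 2 * (w ⬝ᵥ α) + w ⬝ᵥ H *ᵥ w) : H *ᵥ argmin f = α := by
  have hdet := hH.isUnit_det hl
  set w₀ : Fin p → ℝ := H⁻¹ *ᵥ α with hw₀
  have hHw₀ : H *ᵥ w₀ = α := by
    rw [hw₀, mulVec_mulVec, mul_nonsing_inv _ hdet, one_mulVec]
  have key : ∀ w, f w = f w₀ + (w - w₀) ⬝ᵥ H *ᵥ (w - w₀) := by
    intro w
    have h1 : w₀ ⬝ᵥ H *ᵥ w = w ⬝ᵥ α := by
      rw [dotProduct_mulVec, ← mulVec_transpose, hsym, hHw₀, dotProduct_comm]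
    rw [hf, hf, mulVec_sub, sub_dotProduct, dotProduct_sub, dotProduct_sub, h1, hHw₀]
    ring
  have hnn : ∀ w : Fin p → ℝ, 0 ≤ w ⬝ᵥ H *ᵥ w := fun w =>
    (mul_nonneg hl.le (sq_nonneg _)).trans (hH w)
  have hex : ∃ w, ∀ v, f w ≤ f v := ⟨w₀, fun v => by rw [key v]; linarith [hnn (v - w₀)]⟩
  have h2 := argmin_le f hex w₀
  rw [key (argmin f)] at h2
  have h3 := hH (argmin f - w₀)
  have h4 : vecNorm (argmin f - w₀) ^ 2 = 0 := by
    have := sq_nonneg (vecNorm (argmin f - w₀))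
    nlinarith
  rw [eq_of_vecNorm_sub_eq_zero (pow_eq_zero_iff (two_ne_zero) |>.1 h4), hHw₀]

/-- The quadratic form of a real symmetric matrix is bounded below by the infimum of its
spectrum. -/
theorem coercive_sInf_spectrum {H : Matrix (Fin p) (Fin p) ℝ} (hsym : Hᵀ = H) :
    Coercive H (sInf (spectrum ℝ H)) := by
  set l := sInf (spectrum ℝ H) with hl
  have hbdd : BddBelow (spectrum ℝ H) := Matrix.finite_real_spectrum.bddBelow
  have hHh : H.IsHermitian := by
    rw [Matrix.IsHermitian, conjTranspose_eq_transpose_of_trivial, hsym]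
  have hherm : (H - algebraMap ℝ (Matrix (Fin p) (Fin p) ℝ) l).IsHermitian := by
    refine hHh.sub ?_
    rw [Matrix.IsHermitian, conjTranspose_eq_transpose_of_trivial, algebraMap_eq_diagonal,
      diagonal_transpose]
  have hpsd : (H - algebraMap ℝ (Matrix (Fin p) (Fin p) ℝ) l).PosSemidef := by
    rw [hherm.posSemidef_iff_eigenvalues_nonneg]
    intro i
    have h1 := hherm.eigenvalues_mem_spectrum_real i
    have h2 : hherm.eigenvalues i + l ∈ spectrum ℝ H := by
      rwa [spectrum.add_mem_iff, neg_add_eq_sub]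
    have h3 := csInf_le hbdd h2
    show 0 ≤ hherm.eigenvalues i
    linarith
  intro w
  have h := hpsd.dotProduct_mulVec_nonneg w
  rw [sub_mulVec, dotProduct_sub, Algebra.algebraMap_eq_smul_one, smul_mulVec, one_mulVec,
    dotProduct_smul] at h
  simp only [star_trivial, smul_eq_mul] at h
  rw [vecNorm_sq]
  linarith

end LinearAlgebra

/-! ### Perturbation of Krylov sequences in a Hilbert space -/

section Krylov

open Finset
open scoped RealInnerProductSpace

/-- The sum of a nonnegative solution of a contracting recursion, bounded by that of its input. -/
theorem sum_le_of_contraction {u c : ℕ → ℝ} {κ : ℝ} (hκ : κ < 1) (hu : ∀ j, 0 ≤ u j)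
    (hrec : ∀ j, u (j + 1) ≤ κ * u j + c j) (n : ℕ) :
    ∑ j ∈ range n, u j ≤ (u 0 + ∑ j ∈ range n, c j) / (1 - κ) := by
  rw [le_div_iff₀ (by linarith)]
  have h1 : ∑ j ∈ range n, u j ≤ ∑ j ∈ range (n + 1), u j := by
    rw [sum_range_succ]
    linarith [hu n]
  have h2 : ∑ j ∈ range n, u (j + 1) ≤ κ * ∑ j ∈ range n, u j + ∑ j ∈ range n, c j := by
    rw [mul_sum, ← sum_add_distrib]
    exact sum_le_sum fun j _ => hrec j
  rw [sum_range_succ'] at h1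
  nlinarith

variable {E : Type*} [NormedAddCommGroup E] [InnerProductSpace ℝ E]

/-- A first-order perturbation of a Krylov sequence: the operator `K` and the starting vector `v`
are perturbed to `K + s Ξ - m ⊗ m` and `v + s ξ₀ - y m`, where `s` stands for `n^{-1/2}`. -/
structure KrylovPerturbation (E : Type*) [NormedAddCommGroup E] [InnerProductSpace ℝ E] where
  /-- the unperturbed operator -/
  K : E →L[ℝ] E
  /-- the first-order term of the perturbed operator -/
  Ξ : E →L[ℝ] E
  /-- the unperturbed starting vector -/
  v : E
  /-- the first-order term of the perturbed starting vector -/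
  ξ₀ : E
  /-- the vector giving the second-order terms -/
  m : E
  /-- the scalar giving the second-order term of the starting vector -/
  y : ℝ
  /-- the size of the perturbation -/
  s : ℝ

namespace KrylovPerturbation

variable (D : KrylovPerturbation E)

/-- The unperturbed sequence `K^j v`. -/
noncomputable def base (j : ℕ) : E := D.K^[j] D.v

/-- The perturbed operator. -/
noncomputable def pertOp : E →L[ℝ] E := D.K + D.s • D.Ξ - (innerSL ℝ D.m).smulRight D.m

/-- The perturbed sequence. -/
noncomputable def pert (j : ℕ) : E := D.pertOp^[j] (D.v + D.s • D.ξ₀ - D.y • D.m)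

/-- The first-order term of the perturbed sequence. -/
noncomputable def first : ℕ → E
  | 0 => D.ξ₀
  | j + 1 => D.K (first j) + D.Ξ (D.base j)

/-- The error of the zeroth-order approximation of the perturbed sequence. -/
noncomputable def err₁ (j : ℕ) : E := D.pert j - D.base j

/-- The error of the first-order approximation of the perturbed sequence. -/
noncomputable def err₂ (j : ℕ) : E := D.err₁ j - D.s • D.first j

theorem pertOp_apply (f : E) : D.pertOp f = D.K f + D.s • D.Ξ f - ⟪D.m, f⟫ • D.m := by
  simp [pertOp]

theorem base_succ (j : ℕ) : D.base (j + 1) = D.K (D.base j) :=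
  Function.iterate_succ_apply' _ _ _

theorem pert_succ (j : ℕ) : D.pert (j + 1) = D.pertOp (D.pert j) :=
  Function.iterate_succ_apply' _ _ _

theorem err₁_zero : D.err₁ 0 = D.s • D.ξ₀ - D.y • D.m := by
  simp only [err₁, pert, base, Function.iterate_zero, id]
  abel

theorem err₂_zero : D.err₂ 0 = -(D.y • D.m) := by
  rw [err₂, err₁_zero, first]
  abel

theorem err₁_succ (j : ℕ) : D.err₁ (j + 1)
    = D.pertOp (D.err₁ j) + (D.s • D.Ξ (D.base j) - ⟪D.m, D.base j⟫ • D.m) := by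
  rw [err₁, pert_succ, base_succ, err₁, map_sub, pertOp_apply D (D.base j)]
  abel

theorem err₂_succ (j : ℕ) : D.err₂ (j + 1)
    = D.K (D.err₂ j) + (D.s • D.Ξ (D.err₁ j) - ⟪D.m, D.err₁ j⟫ • D.m
      - ⟪D.m, D.base j⟫ • D.m) := by
  rw [err₂, err₁_succ, err₂, first, pertOp_apply, map_sub, map_smul, smul_add]
  abel

/-- The sizes of the ingredients of a perturbation: `s` is so small that the perturbed operator
is still a contraction. -/
structure Bounded (κ M β : ℝ) : Prop where
  norm_K : ‖D.K‖ ≤ κ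
  norm_v : ‖D.v‖ ≤ β
  norm_Ξ : ‖D.Ξ‖ ≤ M
  norm_ξ₀ : ‖D.ξ₀‖ ≤ M
  norm_m : ‖D.m‖ ≤ M * D.s
  abs_y : |D.y| ≤ M * D.s
  s_pos : 0 < D.s
  s_le : D.s ≤ 1
  small : κ + (M + M ^ 2) * D.s ≤ (1 + κ) / 2

variable {D} {κ M β : ℝ}

theorem Bounded.norm_rankOne_le (h : D.Bounded κ M β) (f : E) :
    ‖⟪D.m, f⟫ • D.m‖ ≤ M ^ 2 * D.s ^ 2 * ‖f‖ := by
  rw [norm_smul, Real.norm_eq_abs]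
  calc |⟪D.m, f⟫| * ‖D.m‖ ≤ (‖D.m‖ * ‖f‖) * ‖D.m‖ :=
        mul_le_mul_of_nonneg_right (abs_real_inner_le_norm _ _) (norm_nonneg _)
    _ = ‖D.m‖ ^ 2 * ‖f‖ := by ring
    _ ≤ (M * D.s) ^ 2 * ‖f‖ := by
        gcongr
        exact h.norm_m
    _ = _ := by ring

theorem Bounded.norm_pertOp_sub_le (h : D.Bounded κ M β) (f : E) :
    ‖D.s • D.Ξ f - ⟪D.m, f⟫ • D.m‖ ≤ (M + M ^ 2) * D.s * ‖f‖ := by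
  have hs := h.s_pos
  have h1 : ‖D.s • D.Ξ f‖ ≤ D.s * (M * ‖f‖) := by
    rw [norm_smul, Real.norm_of_nonneg hs.le]
    exact mul_le_mul_of_nonneg_left (D.Ξ.le_of_opNorm_le h.norm_Ξ f) hs.le
  have h2 := h.norm_rankOne_le f
  have h3 : M ^ 2 * D.s ^ 2 * ‖f‖ ≤ M ^ 2 * D.s * ‖f‖ := by
    have : D.s ^ 2 ≤ D.s := by nlinarith [h.s_le]
    gcongr
  calc _ ≤ _ := norm_sub_le _ _
    _ ≤ D.s * (M * ‖f‖) + M ^ 2 * D.s * ‖f‖ := add_le_add h1 (h2.trans h3)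
    _ = _ := by ring

theorem Bounded.norm_pertOp_apply_le (h : D.Bounded κ M β) (f : E) :
    ‖D.pertOp f‖ ≤ (1 + κ) / 2 * ‖f‖ := by
  rw [pertOp_apply, add_sub_assoc]
  calc _ ≤ _ := norm_add_le _ _
    _ ≤ κ * ‖f‖ + (M + M ^ 2) * D.s * ‖f‖ :=
        add_le_add (D.K.le_of_opNorm_le h.norm_K f) (h.norm_pertOp_sub_le f)
    _ = (κ + (M + M ^ 2) * D.s) * ‖f‖ := by ring
    _ ≤ _ := mul_le_mul_of_nonneg_right h.small (norm_nonneg _)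

/-- The sequences of a perturbation are summable, with sums of the orders that first-order
expansion suggests. The `ℓ¹` norms over `j` are bounded by a constant `B` that does not depend on
the number of terms. -/
structure SumBounds (D : KrylovPerturbation E) (M B : ℝ) : Prop where
  base (n : ℕ) : ∑ j ∈ range n, ‖D.base j‖ ≤ B
  first (n : ℕ) : ∑ j ∈ range n, ‖D.first j‖ ≤ B
  err₁ (n : ℕ) : ∑ j ∈ range n, ‖D.err₁ j‖ ≤ B * D.s
  err₂ (n : ℕ) : ∑ j ∈ range n, ‖D.err₂ j‖ ≤ B * D.s ^ 2
  norm_m : ‖D.m‖ ≤ M * D.s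
  s_pos : 0 < D.s
  s_le : D.s ≤ 1

/-- The norms of the four sequences satisfy linear recursions with factors at most
`(1 + κ) / 2 < 1`, so each sum is bounded by the sum of the driving terms. -/
theorem Bounded.exists_sumBounds (hκ : κ < 1) (M β : ℝ) :
    ∃ B, 1 ≤ B ∧ ∀ D : KrylovPerturbation E, D.Bounded κ M β → D.SumBounds M B := by
  set M₁ : ℝ := M + M ^ 2 with hM₁
  set SA := β / (1 - κ) with hSA
  set S1 := (M + M * SA) / (1 - κ) with hS1
  set SU := (M₁ + M₁ * SA) / (1 - (1 + κ) / 2) with hSU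
  set SV := (M ^ 2 + (M₁ * SU + M ^ 2 * SA)) / (1 - κ) with hSV
  refine ⟨max (max (max SA S1) (max SU SV)) 1, le_max_right _ _, fun D h => ?_⟩
  have hs := h.s_pos
  have hs1 := h.s_le
  have hM : 0 ≤ M := (norm_nonneg _).trans h.norm_Ξ
  have hM₁0 : 0 ≤ M₁ := by positivity
  have hκ1 : 0 < 1 - κ := by linarith
  have hκ2 : 0 < 1 - (1 + κ) / 2 := by linarith
  have hA : ∀ n, ∑ j ∈ range n, ‖D.base j‖ ≤ SA := by
    intro n
    refine (sum_le_of_contraction (c := fun _ => 0) hκ (fun _ => norm_nonneg _)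
      (fun j => ?_) n).trans ?_
    · rw [base_succ, add_zero]
      exact D.K.le_of_opNorm_le h.norm_K _
    · rw [sum_const_zero, add_zero]
      exact div_le_div_of_nonneg_right h.norm_v hκ1.le
  have h1 : ∀ n, ∑ j ∈ range n, ‖D.first j‖ ≤ S1 := by
    intro n
    refine (sum_le_of_contraction (c := fun j => M * ‖D.base j‖) hκ (fun _ => norm_nonneg _)
      (fun j => ?_) n).trans ?_
    · exact (norm_add_le _ _).trans (add_le_add (D.K.le_of_opNorm_le h.norm_K _)
        (D.Ξ.le_of_opNorm_le h.norm_Ξ _))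
    · rw [← mul_sum]
      exact div_le_div_of_nonneg_right
        (add_le_add h.norm_ξ₀ (mul_le_mul_of_nonneg_left (hA n) hM)) hκ1.le
  have hy : ‖D.y • D.m‖ ≤ M ^ 2 * D.s ^ 2 := by
    rw [norm_smul, Real.norm_eq_abs]
    calc |D.y| * ‖D.m‖ ≤ (M * D.s) * (M * D.s) :=
          mul_le_mul h.abs_y h.norm_m (norm_nonneg _) (by positivity)
      _ = _ := by ring
  have hU : ∀ n, ∑ j ∈ range n, ‖D.err₁ j‖ ≤ SU * D.s := by
    intro n
    refine (sum_le_of_contraction (c := fun j => M₁ * D.s * ‖D.base j‖) (κ := (1 + κ) / 2)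
      (by linarith) (fun _ => norm_nonneg _) (fun j => ?_) n).trans ?_
    · rw [err₁_succ]
      exact (norm_add_le _ _).trans (add_le_add (h.norm_pertOp_apply_le _) (h.norm_pertOp_sub_le _))
    · rw [← mul_sum, hSU, div_mul_eq_mul_div]
      refine div_le_div_of_nonneg_right ?_ hκ2.le
      have h2 : ‖D.err₁ 0‖ ≤ M₁ * D.s := by
        rw [err₁_zero]
        refine (norm_sub_le _ _).trans ?_
        have h3 : ‖D.s • D.ξ₀‖ ≤ D.s * M := by
          rw [norm_smul, Real.norm_of_nonneg hs.le]
          exact mul_le_mul_of_nonneg_left h.norm_ξ₀ hs.le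
        have h4 : M ^ 2 * D.s ^ 2 ≤ M ^ 2 * D.s := by
          have : D.s ^ 2 ≤ D.s := by nlinarith
          gcongr
        rw [hM₁]
        linarith
      have h5 := mul_le_mul_of_nonneg_left (hA n) (mul_nonneg hM₁0 hs.le)
      linarith
  have hV : ∀ n, ∑ j ∈ range n, ‖D.err₂ j‖ ≤ SV * D.s ^ 2 := by
    intro n
    refine (sum_le_of_contraction
      (c := fun j => M₁ * D.s * ‖D.err₁ j‖ + M ^ 2 * D.s ^ 2 * ‖D.base j‖)
      hκ (fun _ => norm_nonneg _) (fun j => ?_) n).trans ?_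
    · rw [err₂_succ]
      refine (norm_add_le _ _).trans (add_le_add (D.K.le_of_opNorm_le h.norm_K _) ?_)
      exact (norm_sub_le _ _).trans (add_le_add (h.norm_pertOp_sub_le _) (h.norm_rankOne_le _))
    · rw [sum_add_distrib, ← mul_sum, ← mul_sum, hSV, div_mul_eq_mul_div]
      refine div_le_div_of_nonneg_right ?_ hκ1.le
      have h2 : ‖D.err₂ 0‖ ≤ M ^ 2 * D.s ^ 2 := by
        rw [err₂_zero, norm_neg]
        exact hy
      have h5 := mul_le_mul_of_nonneg_left (hU n) (mul_nonneg hM₁0 hs.le)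
      have h6 := mul_le_mul_of_nonneg_left (hA n) (mul_nonneg (sq_nonneg M) (sq_nonneg D.s))
      linarith
  set B := max (max (max SA S1) (max SU SV)) 1 with hB
  have b1 : SA ≤ B := (le_max_left _ _).trans ((le_max_left _ _).trans (le_max_left _ _))
  have b2 : S1 ≤ B := (le_max_right _ _).trans ((le_max_left _ _).trans (le_max_left _ _))
  have b3 : SU ≤ B := (le_max_left _ _).trans ((le_max_right _ _).trans (le_max_left _ _))
  have b4 : SV ≤ B := (le_max_right _ _).trans ((le_max_right _ _).trans (le_max_left _ _))
  exact ⟨fun n => (hA n).trans b1, fun n => (h1 n).trans b2,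
    fun n => (hU n).trans (mul_le_mul_of_nonneg_right b3 hs.le),
    fun n => (hV n).trans (mul_le_mul_of_nonneg_right b4 (sq_nonneg _)), h.norm_m, hs, hs1⟩

end KrylovPerturbation

end Krylov

/-! ### Perturbation of the normal equations -/

section NormalEquations

open Finset Matrix
open scoped RealInnerProductSpace

variable {E : Type*} [NormedAddCommGroup E] [InnerProductSpace ℝ E] {p : ℕ}

/-- The matrix `⟪f_{j+1}, f_k⟫`, `j, k < p`. For `f_j = K^{j+1} b` it is the matrix of the normal
equations of partial least squares. -/
noncomputable def gram (f : ℕ → E) (p : ℕ) : Matrix (Fin p) (Fin p) ℝ :=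
  Matrix.of fun j k => ⟪f (j + 1), f k⟫

/-- The vector `⟪f_0, f_k⟫`, `k < p`, the right-hand side of the normal equations. -/
noncomputable def gramVec (f : ℕ → E) (p : ℕ) : Fin p → ℝ := fun k => ⟪f 0, f k⟫

/-- The derivative of `gram` at `f` in direction `g`. -/
noncomputable def gramDeriv (f g : ℕ → E) (p : ℕ) : Matrix (Fin p) (Fin p) ℝ :=
  Matrix.of fun j k => ⟪g (j + 1), f k⟫ + ⟪f (j + 1), g k⟫

/-- The derivative of `gramVec` at `f` in direction `g`. -/
noncomputable def gramVecDeriv (f g : ℕ → E) (p : ℕ) : Fin p → ℝ :=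
  fun k => ⟪g 0, f k⟫ + ⟪f 0, g k⟫

theorem sum_abs_inner_le {q : ℕ} {f : Fin q → E} {g : Fin p → E} {a b : ℝ}
    (hf : ∑ j, ‖f j‖ ≤ a) (hg : ∑ k, ‖g k‖ ≤ b) : ∑ j, ∑ k, |⟪f j, g k⟫| ≤ a * b := by
  calc ∑ j, ∑ k, |⟪f j, g k⟫| ≤ ∑ j, ∑ k, ‖f j‖ * ‖g k‖ :=
        sum_le_sum fun j _ => sum_le_sum fun k _ => abs_real_inner_le_norm _ _
    _ = (∑ j, ‖f j‖) * ∑ k, ‖g k‖ := by rw [sum_mul_sum]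
    _ ≤ a * b := mul_le_mul hf hg (sum_nonneg fun _ _ => norm_nonneg _)
        ((sum_nonneg fun _ _ => norm_nonneg _).trans hf)

theorem sum_abs_add_three_le {q : ℕ} {x y z : Fin q → Fin p → ℝ} {a b c : ℝ}
    (hx : ∑ j, ∑ k, |x j k| ≤ a) (hy : ∑ j, ∑ k, |y j k| ≤ b) (hz : ∑ j, ∑ k, |z j k| ≤ c) :
    ∑ j, ∑ k, |x j k + y j k + z j k| ≤ a + b + c := by
  calc _ ≤ ∑ j, ∑ k, (|x j k| + |y j k| + |z j k|) :=
        sum_le_sum fun j _ => sum_le_sum fun k _ => abs_add_three _ _ _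
    _ = ∑ j, ∑ k, |x j k| + ∑ j, ∑ k, |y j k| + ∑ j, ∑ k, |z j k| := by
        simp only [sum_add_distrib]
    _ ≤ _ := add_le_add (add_le_add hx hy) hz

theorem sum_norm_fin_le {E : Type*} [NormedAddCommGroup E] {f : ℕ → E} {B : ℝ}
    (h : ∀ n, ∑ j ∈ range n, ‖f j‖ ≤ B) :
    ∑ j : Fin p, ‖f j‖ ≤ B := by
  rw [Fin.sum_univ_eq_sum_range (fun j => ‖f j‖)]
  exact h p

theorem sum_norm_fin_succ_le {E : Type*} [NormedAddCommGroup E] {f : ℕ → E} {B : ℝ}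
    (h : ∀ n, ∑ j ∈ range n, ‖f j‖ ≤ B) :
    ∑ j : Fin p, ‖f (j + 1)‖ ≤ B := by
  rw [Fin.sum_univ_eq_sum_range (fun j => ‖f (j + 1)‖)]
  have h1 := h (p + 1)
  rw [sum_range_succ'] at h1
  linarith [norm_nonneg (f 0)]

theorem sum_norm_fin_one_le {E : Type*} [NormedAddCommGroup E] {f : ℕ → E} {B : ℝ}
    (h : ∀ n, ∑ j ∈ range n, ‖f j‖ ≤ B) :
    ∑ _j : Fin 1, ‖f 0‖ ≤ B := by
  simpa using h 1

theorem sum_abs_inner_mul_le {f : ℕ → E} {B Z : ℝ}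
    (h : ∀ n, ∑ j ∈ range n, ‖f j‖ ≤ B) {z : E} (hz : ‖z‖ ≤ Z) :
    ∑ j : Fin p, |⟪z, f j⟫| ≤ Z * B := by
  calc _ ≤ ∑ j : Fin p, ‖z‖ * ‖f j‖ := sum_le_sum fun j _ => abs_real_inner_le_norm _ _
    _ = ‖z‖ * ∑ j : Fin p, ‖f j‖ := by rw [mul_sum]
    _ ≤ Z * B := mul_le_mul hz (sum_norm_fin_le h) (sum_nonneg fun _ _ => norm_nonneg _)
        ((norm_nonneg _).trans hz)

namespace KrylovPerturbation

variable {D : KrylovPerturbation E} {M B : ℝ}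

theorem pert_eq (j : ℕ) : D.pert j = D.base j + D.err₁ j := by
  rw [err₁]
  abel

theorem inner_pert_sub (i j : ℕ) : ⟪D.pert i, D.pert j⟫ - ⟪D.base i, D.base j⟫
    = ⟪D.err₁ i, D.base j⟫ + ⟪D.base i, D.err₁ j⟫ + ⟪D.err₁ i, D.err₁ j⟫ := by
  rw [pert_eq, pert_eq, inner_add_left, inner_add_right, inner_add_right]
  ring

theorem inner_pert_sub_sub (i j : ℕ) : ⟪D.pert i, D.pert j⟫ - ⟪D.base i, D.base j⟫
      - D.s * (⟪D.first i, D.base j⟫ + ⟪D.base i, D.first j⟫)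
    = ⟪D.err₂ i, D.base j⟫ + ⟪D.base i, D.err₂ j⟫ + ⟪D.err₁ i, D.err₁ j⟫ := by
  rw [inner_pert_sub, err₂, err₂, inner_sub_left, inner_sub_right, real_inner_smul_left,
    real_inner_smul_right]
  ring

theorem SumBounds.three_le (hB : 1 ≤ B) (h : D.SumBounds M B) :
    B * D.s * B + B * (B * D.s) + B * D.s * (B * D.s) ≤ 3 * B ^ 2 * D.s := by
  have hs := h.s_pos
  have : B ^ 2 * D.s * D.s ≤ B ^ 2 * D.s * 1 :=
    mul_le_mul_of_nonneg_left h.s_le (by positivity)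
  nlinarith

theorem SumBounds.gram_sub (hB : 1 ≤ B) (h : D.SumBounds M B) :
    ∑ j, ∑ k, |(gram D.pert p - gram D.base p) j k| ≤ 3 * B ^ 2 * D.s := by
  simp only [Matrix.sub_apply, gram, Matrix.of_apply, inner_pert_sub]
  exact (sum_abs_add_three_le
    (sum_abs_inner_le (sum_norm_fin_succ_le h.err₁) (sum_norm_fin_le h.base))
    (sum_abs_inner_le (sum_norm_fin_succ_le h.base) (sum_norm_fin_le h.err₁))
    (sum_abs_inner_le (sum_norm_fin_succ_le h.err₁) (sum_norm_fin_le h.err₁))).trans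
    (h.three_le hB)

theorem SumBounds.gramVec_sub (hB : 1 ≤ B) (h : D.SumBounds M B) :
    vecNorm (gramVec D.pert p - gramVec D.base p) ≤ 3 * B ^ 2 * D.s := by
  refine (vecNorm_le_sum_abs _).trans ?_
  simp only [Pi.sub_apply, gramVec, inner_pert_sub]
  have := (sum_abs_add_three_le
    (sum_abs_inner_le (sum_norm_fin_one_le h.err₁) (sum_norm_fin_le (p := p) h.base))
    (sum_abs_inner_le (sum_norm_fin_one_le h.base) (sum_norm_fin_le h.err₁))
    (sum_abs_inner_le (sum_norm_fin_one_le h.err₁) (sum_norm_fin_le h.err₁))).trans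
    (h.three_le hB)
  simpa using this

theorem SumBounds.gram_sub_sub (h : D.SumBounds M B) :
    ∑ j, ∑ k, |(gram D.pert p - gram D.base p - D.s • gramDeriv D.base D.first p) j k|
      ≤ 3 * B ^ 2 * D.s ^ 2 := by
  simp only [Matrix.sub_apply, Matrix.smul_apply, smul_eq_mul, gram, gramDeriv, Matrix.of_apply,
    inner_pert_sub_sub]
  exact (sum_abs_add_three_le
    (sum_abs_inner_le (sum_norm_fin_succ_le h.err₂) (sum_norm_fin_le h.base))
    (sum_abs_inner_le (sum_norm_fin_succ_le h.base) (sum_norm_fin_le h.err₂))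
    (sum_abs_inner_le (sum_norm_fin_succ_le h.err₁) (sum_norm_fin_le h.err₁))).trans
    (le_of_eq (by ring))

theorem SumBounds.gramVec_sub_sub (h : D.SumBounds M B) :
    vecNorm (gramVec D.pert p - gramVec D.base p - D.s • gramVecDeriv D.base D.first p)
      ≤ 3 * B ^ 2 * D.s ^ 2 := by
  refine (vecNorm_le_sum_abs _).trans ?_
  simp only [Pi.sub_apply, Pi.smul_apply, smul_eq_mul, gramVec, gramVecDeriv, inner_pert_sub_sub]
  have := (sum_abs_add_three_le
    (sum_abs_inner_le (sum_norm_fin_one_le h.err₂) (sum_norm_fin_le (p := p) h.base))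
    (sum_abs_inner_le (sum_norm_fin_one_le h.base) (sum_norm_fin_le h.err₂))
    (sum_abs_inner_le (sum_norm_fin_one_le h.err₁) (sum_norm_fin_le h.err₁))).trans
    (le_of_eq (by ring : _ = 3 * B ^ 2 * D.s ^ 2))
  simpa using this

/-- A lower bound of the matrix of the normal equations cannot exceed its first entry. -/
theorem SumBounds.lowerBound_le (hB : 1 ≤ B) (h : D.SumBounds M B) (hp : 0 < p) {l : ℝ}
    (hH : Coercive (gram D.base p) l) : l ≤ 3 * B ^ 2 := by
  have h1 := hH (Pi.single ⟨0, hp⟩ 1)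
  have h2 : vecNorm (Pi.single ⟨0, hp⟩ 1 : Fin p → ℝ) ^ 2 = 1 := by
    rw [vecNorm_sq]
    simp
  rw [h2, mul_one] at h1
  have h3 : ‖D.base 0‖ ≤ B := by simpa using h.base 1
  have h4 : ‖D.base 1‖ ≤ B := by
    have := h.base 2
    rw [sum_range_succ, sum_range_one] at this
    linarith [norm_nonneg (D.base 0)]
  have h5 : ⟪D.base 1, D.base 0⟫ ≤ B * B := (real_inner_le_norm _ _).trans
    (mul_le_mul h4 h3 (norm_nonneg _) (by linarith))
  have h6 : (Pi.single ⟨0, hp⟩ 1 : Fin p → ℝ) ⬝ᵥ gram D.base p *ᵥ Pi.single ⟨0, hp⟩ 1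
      = ⟪D.base 1, D.base 0⟫ := by
    simp [gram]
  nlinarith

/-- The first-order expansion of the solution of the perturbed normal equations. The largest
error is the difference of the two matrix inverses, of order `s * l⁻¹ ^ 2`, applied to a vector of
order `s * ‖γ‖`, that is `s * l⁻¹`. -/
theorem SumBounds.coefficients (hB : 1 ≤ B) (h : D.SumBounds M B) (hp : 0 < p) {l : ℝ}
    (hl : 0 < l) (hH : Coercive (gram D.base p) l) (hsmall : 3 * B ^ 2 * D.s ≤ l / 2)
    {γ γh c : Fin p → ℝ} (hγ : gram D.base p *ᵥ γ = gramVec D.base p)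
    (hγh : gram D.pert p *ᵥ γh = gramVec D.pert p)
    (hc : gram D.base p *ᵥ c
      = gramVecDeriv D.base D.first p - gramDeriv D.base D.first p *ᵥ γ) :
    vecNorm γ ≤ (3 * B ^ 2) * l⁻¹ ∧
    vecNorm (γh - γ) ≤ 4 * (3 * B ^ 2) ^ 2 * D.s * l⁻¹ ^ 2 ∧
    vecNorm (γh - (γ + D.s • c)) ≤ 6 * (3 * B ^ 2) ^ 3 * D.s ^ 2 * l⁻¹ ^ 3 := by
  have hlG := h.lowerBound_le hB hp hH
  have hD := h.gram_sub hB (p := p)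
  have hd := h.gramVec_sub hB (p := p)
  have hR := h.gram_sub_sub (p := p)
  have hr := h.gramVec_sub_sub (p := p)
  have hs := h.s_pos
  set G := 3 * B ^ 2 with hG
  have hG0 : 0 < G := by positivity
  set s := D.s
  set H := gram D.base p
  set Hh := gram D.pert p
  set α := gramVec D.base p with hα
  set αh := gramVec D.pert p
  set Δ := gramDeriv D.base D.first p
  set δ := gramVecDeriv D.base D.first p
  have hαG : vecNorm α ≤ G := by
    refine (vecNorm_le_sum_abs _).trans ?_
    have := sum_abs_inner_le (sum_norm_fin_one_le h.base) (sum_norm_fin_le (p := p) h.base)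
    have h2 : ∑ k, |α k| ≤ B * B := by simpa [hα, gramVec] using this
    nlinarith
  -- the size of the unperturbed solution
  have hγn : vecNorm γ ≤ G * l⁻¹ := by
    have := hH.mul_vecNorm_le γ
    rw [hγ] at this
    rw [← div_eq_mul_inv, le_div_iff₀ hl]
    linarith
  have hγ1 : 1 + vecNorm γ ≤ 2 * G * l⁻¹ := by
    have : 1 ≤ G * l⁻¹ := by rwa [← div_eq_mul_inv, le_div_iff₀ hl, one_mul]
    linarith
  have hHh : Coercive Hh (l / 2) := by
    have := hH.perturb (D := Hh - H) (hD.trans hsmall)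
    rwa [add_sub_cancel] at this
  have hli : l⁻¹ * l = 1 := inv_mul_cancel₀ hl.ne'
  have hl0 : 0 < l⁻¹ := inv_pos.2 hl
  have hγ0 := vecNorm_nonneg γ
  -- the zeroth-order error
  have he : vecNorm (γh - γ) ≤ 4 * G ^ 2 * s * l⁻¹ ^ 2 := by
    have h1 : Hh *ᵥ (γh - γ) = (αh - α) - (Hh - H) *ᵥ γ := by
      rw [mulVec_sub, sub_mulVec, hγh, hγ]
      abel
    have h2 := hHh.mul_vecNorm_le (γh - γ)
    have h3 : vecNorm (Hh *ᵥ (γh - γ)) ≤ G * s * (2 * G * l⁻¹) := by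
      rw [h1]
      calc _ ≤ vecNorm (αh - α) + vecNorm ((Hh - H) *ᵥ γ) := vecNorm_sub_le _ _
        _ ≤ G * s + G * s * vecNorm γ := add_le_add hd
            ((vecNorm_mulVec_le _ _).trans (mul_le_mul_of_nonneg_right hD hγ0))
        _ = G * s * (1 + vecNorm γ) := by ring
        _ ≤ _ := mul_le_mul_of_nonneg_left hγ1 (by positivity)
    calc vecNorm (γh - γ) = 2 * l⁻¹ * (l / 2 * vecNorm (γh - γ)) := by
          linear_combination (-vecNorm (γh - γ)) * hli
      _ ≤ 2 * l⁻¹ * (G * s * (2 * G * l⁻¹)) :=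
          mul_le_mul_of_nonneg_left (h2.trans h3) (by positivity)
      _ = _ := by ring
  refine ⟨hγn, he, ?_⟩
  have h1 : H *ᵥ (γh - (γ + s • c)) = (αh - α - s • δ) - (Hh - H - s • Δ) *ᵥ γ
      - (Hh - H) *ᵥ (γh - γ) := by
    simp only [mulVec_sub, mulVec_add, mulVec_smul, sub_mulVec, smul_mulVec, hγ, hγh, hc, smul_sub]
    abel
  have h2 := hH.mul_vecNorm_le (γh - (γ + s • c))
  have h3 : vecNorm (H *ᵥ (γh - (γ + s • c))) ≤ G * s ^ 2 * (2 * G * l⁻¹)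
      + G * s * (4 * G ^ 2 * s * l⁻¹ ^ 2) := by
    rw [h1]
    refine (vecNorm_sub_le _ _).trans (add_le_add ?_ ?_)
    · calc _ ≤ _ := vecNorm_sub_le _ _
        _ ≤ G * s ^ 2 + G * s ^ 2 * vecNorm γ := add_le_add hr
            ((vecNorm_mulVec_le _ _).trans (mul_le_mul_of_nonneg_right hR hγ0))
        _ = G * s ^ 2 * (1 + vecNorm γ) := by ring
        _ ≤ _ := mul_le_mul_of_nonneg_left hγ1 (by positivity)
    · exact (vecNorm_mulVec_le _ _).trans (mul_le_mul hD he (vecNorm_nonneg _) (by positivity))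
  calc vecNorm (γh - (γ + s • c)) = l⁻¹ * (l * vecNorm (γh - (γ + s • c))) := by
        linear_combination (-vecNorm (γh - (γ + s • c))) * hli
    _ ≤ l⁻¹ * (G * s ^ 2 * (2 * G * l⁻¹) + G * s * (4 * G ^ 2 * s * l⁻¹ ^ 2)) :=
        mul_le_mul_of_nonneg_left (h2.trans h3) hl0.le
    _ = 2 * G ^ 2 * s ^ 2 * l⁻¹ ^ 3 * l + 4 * G ^ 3 * s ^ 2 * l⁻¹ ^ 3 := by
        linear_combination (-2 * G ^ 2 * s ^ 2 * l⁻¹ ^ 2) * hli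
    _ ≤ 2 * G ^ 2 * s ^ 2 * l⁻¹ ^ 3 * G + 4 * G ^ 3 * s ^ 2 * l⁻¹ ^ 3 := by gcongr
    _ = _ := by ring

/-- The first-order expansion of the predictor. The remainder splits into six sums, each
pairing a coefficient vector with one of the sequences; `11` and `9` add up their constants, after
powers of `3 * B ^ 2 * l⁻¹ ≥ 1` have brought all of them to the rate `l⁻¹ ^ 3`. -/
theorem SumBounds.prediction (hB : 1 ≤ B) (h : D.SumBounds M B) (hp : 0 < p) {l : ℝ}
    (hl : 0 < l) (hH : Coercive (gram D.base p) l) (hsmall : 3 * B ^ 2 * D.s ≤ l / 2)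
    {γ γh c : Fin p → ℝ} (hγ : gram D.base p *ᵥ γ = gramVec D.base p)
    (hγh : gram D.pert p *ᵥ γh = gramVec D.pert p)
    (hc : gram D.base p *ᵥ c
      = gramVecDeriv D.base D.first p - gramDeriv D.base D.first p *ᵥ γ)
    {z : E} {Z : ℝ} (hz : ‖z‖ ≤ Z) (hM : 0 ≤ M) :
    |∑ j, γh j * ⟪z - D.m, D.pert j⟫ - ∑ j, γ j * ⟪z, D.base j⟫
      - D.s * ∑ j, (c j * ⟪z, D.base j⟫
        + γ j * (⟪z, D.first j⟫ - D.s⁻¹ * ⟪D.m, D.base j⟫))|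
      ≤ B * (3 * B ^ 2) ^ 3 * (11 * Z + 9 * M) * D.s ^ 2 * l⁻¹ ^ 3 := by
  obtain ⟨h1, h2, h3⟩ := h.coefficients hB hp hl hH hsmall hγ hγh hc
  have hlG := h.lowerBound_le hB hp hH
  have hs := h.s_pos
  have hs1 := h.s_le
  have hB0 : 0 < B := by linarith
  have hZ : 0 ≤ Z := (norm_nonneg _).trans hz
  set G := 3 * B ^ 2 with hG
  have hG0 : 0 < G := by positivity
  have hli : l⁻¹ * l = 1 := inv_mul_cancel₀ hl.ne'
  have hl0 : 0 < l⁻¹ := inv_pos.2 hl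
  have hlG1 : 1 ≤ G * l⁻¹ := by rwa [← div_eq_mul_inv, le_div_iff₀ hl, one_mul]
  have hdecomp : ∑ j, γh j * ⟪z - D.m, D.pert j⟫ - ∑ j, γ j * ⟪z, D.base j⟫
      - D.s * ∑ j, (c j * ⟪z, D.base j⟫
        + γ j * (⟪z, D.first j⟫ - D.s⁻¹ * ⟪D.m, D.base j⟫))
      = ∑ j, (γh - (γ + D.s • c)) j * ⟪z, D.base j⟫
        + (∑ j, γ j * ⟪z, D.err₂ j⟫ - ∑ j, γ j * ⟪D.m, D.err₁ j⟫)
        + (∑ j, (γh - γ) j * ⟪z, D.err₁ j⟫ - ∑ j, (γh - γ) j * ⟪D.m, D.base j⟫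
          - ∑ j, (γh - γ) j * ⟪D.m, D.err₁ j⟫) := by
    rw [mul_sum]
    simp only [← sum_sub_distrib, ← sum_add_distrib]
    refine sum_congr rfl fun j _ => ?_
    rw [pert_eq, KrylovPerturbation.err₂, inner_sub_left, inner_add_right, inner_add_right,
      inner_sub_right, real_inner_smul_right]
    simp only [Pi.sub_apply, Pi.add_apply, Pi.smul_apply, smul_eq_mul]
    field_simp
    ring
  rw [hdecomp]
  have key : ∀ (v : Fin p → ℝ) (f : ℕ → E) (w : E) (a b W : ℝ), vecNorm v ≤ a →
      (∀ n, ∑ j ∈ range n, ‖f j‖ ≤ b) → ‖w‖ ≤ W → |∑ j, v j * ⟪w, f j⟫| ≤ a * (W * b) :=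
    fun v f w a b W hv hf hw => (abs_sum_mul_le_vecNorm_mul_sum v _).trans
      (mul_le_mul hv (sum_abs_inner_mul_le hf hw) (sum_nonneg fun _ _ => abs_nonneg _)
        ((vecNorm_nonneg v).trans hv))
  have k1 := key _ D.base z _ _ _ h3 h.base hz
  have k2 := key _ D.err₂ z _ _ _ h1 h.err₂ hz
  have k3 := key _ D.err₁ D.m _ _ _ h1 h.err₁ h.norm_m
  have k4 := key _ D.err₁ z _ _ _ h2 h.err₁ hz
  have k5 := key _ D.base D.m _ _ _ h2 h.base h.norm_m
  have k6 := key _ D.err₁ D.m _ _ _ h2 h.err₁ h.norm_m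
  have hsq : 1 ≤ (G * l⁻¹) ^ 2 := one_le_pow₀ hlG1
  have e2 : G * l⁻¹ * (Z * (B * D.s ^ 2)) ≤ B * G ^ 3 * Z * D.s ^ 2 * l⁻¹ ^ 3 := by
    calc _ = G * l⁻¹ * (Z * (B * D.s ^ 2)) * 1 := by ring
      _ ≤ G * l⁻¹ * (Z * (B * D.s ^ 2)) * (G * l⁻¹) ^ 2 :=
          mul_le_mul_of_nonneg_left hsq (by positivity)
      _ = _ := by ring
  have e3 : G * l⁻¹ * (M * D.s * (B * D.s)) ≤ B * G ^ 3 * M * D.s ^ 2 * l⁻¹ ^ 3 := by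
    calc _ = G * l⁻¹ * (M * D.s * (B * D.s)) * 1 := by ring
      _ ≤ G * l⁻¹ * (M * D.s * (B * D.s)) * (G * l⁻¹) ^ 2 :=
          mul_le_mul_of_nonneg_left hsq (by positivity)
      _ = _ := by ring
  have e4 : 4 * G ^ 2 * D.s * l⁻¹ ^ 2 * (Z * (B * D.s))
      ≤ 4 * B * G ^ 3 * Z * D.s ^ 2 * l⁻¹ ^ 3 := by
    calc _ = 4 * G ^ 2 * D.s * l⁻¹ ^ 2 * (Z * (B * D.s)) * 1 := by ring
      _ ≤ 4 * G ^ 2 * D.s * l⁻¹ ^ 2 * (Z * (B * D.s)) * (G * l⁻¹) :=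
          mul_le_mul_of_nonneg_left hlG1 (by positivity)
      _ = _ := by ring
  have e5 : 4 * G ^ 2 * D.s * l⁻¹ ^ 2 * (M * D.s * B)
      ≤ 4 * B * G ^ 3 * M * D.s ^ 2 * l⁻¹ ^ 3 := by
    calc _ = 4 * G ^ 2 * D.s * l⁻¹ ^ 2 * (M * D.s * B) * 1 := by ring
      _ ≤ 4 * G ^ 2 * D.s * l⁻¹ ^ 2 * (M * D.s * B) * (G * l⁻¹) :=
          mul_le_mul_of_nonneg_left hlG1 (by positivity)
      _ = _ := by ring
  have e6 : 4 * G ^ 2 * D.s * l⁻¹ ^ 2 * (M * D.s * (B * D.s))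
      ≤ 4 * B * G ^ 3 * M * D.s ^ 2 * l⁻¹ ^ 3 := by
    refine le_trans ?_ e5
    refine mul_le_mul_of_nonneg_left ?_ (by positivity)
    refine mul_le_mul_of_nonneg_left ?_ (by positivity)
    nlinarith
  refine (abs_add_three _ _ _).trans ?_
  refine (add_le_add (add_le_add k1 ((abs_sub _ _).trans (add_le_add k2 k3)))
    ((abs_sub _ _).trans (add_le_add ((abs_sub _ _).trans (add_le_add k4 k5)) k6))).trans ?_
  have e1 : 6 * G ^ 3 * D.s ^ 2 * l⁻¹ ^ 3 * (Z * B) = 6 * B * G ^ 3 * Z * D.s ^ 2 * l⁻¹ ^ 3 := by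
    ring
  linarith

end KrylovPerturbation

end NormalEquations

/-! ### Integral operators with square-integrable kernels -/

section KernelOperators

open scoped ENNReal RealInnerProductSpace

theorem eLpNorm_two_sq {α : Type*} [MeasurableSpace α] (μ : Measure α) (f : α → ℝ) :
    eLpNorm f 2 μ ^ 2 = ∫⁻ x, ‖f x‖ₑ ^ 2 ∂μ := by
  rw [eLpNorm_eq_lintegral_rpow_enorm_toReal (by norm_num) (by norm_num), ← ENNReal.rpow_natCast,
    ← ENNReal.rpow_mul]
  simp

theorem memLp_two_of_lintegral_sq_lt_top {α : Type*} [MeasurableSpace α] {μ : Measure α}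
    {f : α → ℝ} (hf : AEStronglyMeasurable f μ) (h : ∫⁻ x, ‖f x‖ₑ ^ 2 ∂μ < ∞) : MemLp f 2 μ := by
  refine ⟨hf, ?_⟩
  rw [← eLpNorm_two_sq] at h
  exact lt_of_not_ge fun h2 => by simp [top_le_iff.1 h2] at h

theorem lintegral_enorm_mul_le {α : Type*} [MeasurableSpace α] {μ : Measure α} {f g : α → ℝ}
    (hf : AEStronglyMeasurable f μ) (hg : AEStronglyMeasurable g μ) :
    ∫⁻ x, ‖f x‖ₑ * ‖g x‖ₑ ∂μ ≤ eLpNorm f 2 μ * eLpNorm g 2 μ := by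
  have h := eLpNorm_smul_le_mul_eLpNorm (p := 2) (q := 2) (r := 1) hg hf
  rw [eLpNorm_one_eq_lintegral_enorm] at h
  simpa [enorm_mul] using h

theorem enorm_integral_mul_le {α : Type*} [MeasurableSpace α] {μ : Measure α} {f g : α → ℝ}
    (hf : AEStronglyMeasurable f μ) (hg : AEStronglyMeasurable g μ) :
    ‖∫ x, f x * g x ∂μ‖ₑ ≤ eLpNorm f 2 μ * eLpNorm g 2 μ := by
  refine (enorm_integral_le_lintegral_enorm _).trans ?_
  simpa [enorm_mul] using lintegral_enorm_mul_le hf hg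

theorem integrable_fun_mul {α : Type*} [MeasurableSpace α] {μ : Measure α} {f g : α → ℝ}
    (hf : MemLp f 2 μ) (hg : MemLp g 2 μ) : Integrable (fun x => f x * g x) μ :=
  hf.integrable_mul hg

theorem memLp_mul_prod {α β : Type*} [MeasurableSpace α] [MeasurableSpace β] {μ : Measure α}
    {ν : Measure β} [SFinite μ] [SFinite ν] {f : α → ℝ} {g : β → ℝ} (hf : MemLp f 2 μ)
    (hg : MemLp g 2 ν) : MemLp (fun q : α × β => f q.1 * g q.2) 2 (μ.prod ν) := by
  refine memLp_two_of_lintegral_sq_lt_top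
    (hf.aestronglyMeasurable.comp_fst.mul hg.aestronglyMeasurable.comp_snd) ?_
  have h : ∫⁻ q : α × β, ‖f q.1‖ₑ ^ 2 * ‖g q.2‖ₑ ^ 2 ∂(μ.prod ν)
      = (∫⁻ s, ‖f s‖ₑ ^ 2 ∂μ) * ∫⁻ t, ‖g t‖ₑ ^ 2 ∂ν :=
    lintegral_prod_mul (hf.aestronglyMeasurable.enorm.pow_const 2)
      (hg.aestronglyMeasurable.enorm.pow_const 2)
  simp only [enorm_mul, mul_pow]
  rw [h, ← eLpNorm_two_sq, ← eLpNorm_two_sq]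
  exact ENNReal.mul_lt_top (ENNReal.pow_lt_top hf.eLpNorm_lt_top)
    (ENNReal.pow_lt_top hg.eLpNorm_lt_top)

variable {T : Type*} [MeasureSpace T]

/-- The Hilbert space `L²(T)`. -/
abbrev L2 (T : Type*) [MeasureSpace T] := Lp ℝ 2 (volume : Measure T)

theorem integral_mul_eq_inner {f g : T → ℝ} {F G : L2 T} (hf : f =ᵐ[volume] F)
    (hg : g =ᵐ[volume] G) : ∫ t, f t * g t = ⟪F, G⟫ := by
  rw [L2.inner_def]
  refine integral_congr_ae ?_
  filter_upwards [hf, hg] with t h1 h2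
  rw [h1, h2]
  simp [mul_comm]

theorem kerOp_congr (L : T → T → ℝ) {f g : T → ℝ} (h : f =ᵐ[volume] g) :
    kerOp L f = kerOp L g := by
  funext t
  refine integral_congr_ae ?_
  filter_upwards [h] with s hs
  rw [hs]

theorem kerOp_smul (L : T → T → ℝ) (r : ℝ) (f : T → ℝ) : kerOp L (r • f) = r • kerOp L f := by
  funext t
  simp only [kerOp, Pi.smul_apply, smul_eq_mul, mul_assoc]
  exact integral_const_mul _ _

variable [SFinite (volume : Measure T)] {L : T → T → ℝ}

theorem ae_memLp_section (hL : MemLp (Function.uncurry L) 2 (volume.prod volume)) :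
    ∀ᵐ t, MemLp (fun s => L s t) 2 volume := by
  have h1 := hL.aestronglyMeasurable.prod_swap
  have h2 : ∫⁻ t, ∫⁻ s, ‖L s t‖ₑ ^ 2 < ∞ := by
    have h3 := hL.eLpNorm_lt_top
    have h4 : eLpNorm (Function.uncurry L) 2 (volume.prod volume) ^ 2 < ∞ := by
      exact ENNReal.pow_lt_top h3
    rwa [eLpNorm_two_sq, lintegral_prod_symm _ (hL.aestronglyMeasurable.enorm.pow_const 2)] at h4
  have h5 : AEMeasurable (fun t => ∫⁻ s, ‖L s t‖ₑ ^ 2) (volume : Measure T) :=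
    (h1.enorm.pow_const 2).lintegral_prod_right'
  filter_upwards [h1.prodMk_left, ae_lt_top' h5 h2.ne] with t ht1 ht2
  exact memLp_two_of_lintegral_sq_lt_top ht1 ht2

theorem aestronglyMeasurable_kerOp
    (hL : AEStronglyMeasurable (Function.uncurry L) (volume.prod volume)) {f : T → ℝ}
    (hf : AEStronglyMeasurable f volume) : AEStronglyMeasurable (kerOp L f) volume := by
  have h1 : AEStronglyMeasurable (fun q : T × T => f q.2 * L q.2 q.1) (volume.prod volume) :=
    hf.comp_snd.mul hL.prod_swap
  exact h1.integral_prod_right'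

theorem eLpNorm_kerOp_le (hL : MemLp (Function.uncurry L) 2 (volume.prod volume)) {f : T → ℝ}
    (hf : AEStronglyMeasurable f volume) : eLpNorm (kerOp L f) 2 volume
      ≤ eLpNorm (Function.uncurry L) 2 (volume.prod volume) * eLpNorm f 2 volume := by
  rw [← (ENNReal.pow_right_strictMono two_ne_zero).le_iff_le, mul_pow,
    eLpNorm_two_sq volume (kerOp L f), eLpNorm_two_sq (volume.prod volume),
    lintegral_prod_symm _ (hL.aestronglyMeasurable.enorm.pow_const 2)]
  have h5 : AEMeasurable (fun t => ∫⁻ s, ‖L s t‖ₑ ^ 2) (volume : Measure T) :=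
    (hL.aestronglyMeasurable.prod_swap.enorm.pow_const 2).lintegral_prod_right'
  refine le_trans ?_ (lintegral_mul_const'' (eLpNorm f 2 volume ^ 2) h5).le
  refine lintegral_mono_ae ?_
  filter_upwards [ae_memLp_section hL] with t ht
  have h6 := enorm_integral_mul_le hf ht.aestronglyMeasurable
  calc ‖kerOp L f t‖ₑ ^ 2 ≤ (eLpNorm f 2 volume * eLpNorm (fun s => L s t) 2 volume) ^ 2 :=
        pow_le_pow_left' h6 2
    _ = _ := by rw [mul_pow, eLpNorm_two_sq volume fun s => L s t, mul_comm]

theorem memLp_kerOp (hL : MemLp (Function.uncurry L) 2 (volume.prod volume)) {f : T → ℝ}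
    (hf : MemLp f 2 volume) : MemLp (kerOp L f) 2 volume :=
  ⟨aestronglyMeasurable_kerOp hL.aestronglyMeasurable hf.aestronglyMeasurable,
    (eLpNorm_kerOp_le hL hf.aestronglyMeasurable).trans_lt
      (ENNReal.mul_lt_top hL.eLpNorm_lt_top hf.eLpNorm_lt_top)⟩

theorem kerOp_add_ae (hL : MemLp (Function.uncurry L) 2 (volume.prod volume)) {f g : T → ℝ}
    (hf : MemLp f 2 volume) (hg : MemLp g 2 volume) :
    kerOp L (f + g) =ᵐ[volume] kerOp L f + kerOp L g := by
  filter_upwards [ae_memLp_section hL] with t ht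
  simp only [kerOp, Pi.add_apply, add_mul]
  exact integral_add (hf.integrable_mul ht) (hg.integrable_mul ht)

/-- The bounded operator on `L²` with square-integrable kernel `L`. -/
noncomputable def kerCLM (L : T → T → ℝ)
    (hL : MemLp (Function.uncurry L) 2 (volume.prod volume)) : L2 T →L[ℝ] L2 T :=
  LinearMap.mkContinuous
    { toFun := fun F => (memLp_kerOp hL (Lp.memLp F)).toLp
      map_add' := fun F G => by
        rw [← MemLp.toLp_add, MemLp.toLp_eq_toLp_iff, kerOp_congr L (Lp.coeFn_add F G)]
        exact kerOp_add_ae hL (Lp.memLp F) (Lp.memLp G)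
      map_smul' := fun r F => by
        rw [RingHom.id_apply, ← MemLp.toLp_const_smul, MemLp.toLp_eq_toLp_iff,
          kerOp_congr L (Lp.coeFn_smul r F), kerOp_smul] }
    (eLpNorm (Function.uncurry L) 2 (volume.prod volume)).toReal
    (fun F => by
      simp only [LinearMap.coe_mk, AddHom.coe_mk]
      rw [Lp.norm_toLp, Lp.norm_def, ← ENNReal.toReal_mul]
      exact ENNReal.toReal_mono
        (ENNReal.mul_ne_top hL.eLpNorm_ne_top (Lp.memLp F).eLpNorm_ne_top)
        (eLpNorm_kerOp_le hL (Lp.memLp F).aestronglyMeasurable))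

theorem norm_kerCLM_le (hL : MemLp (Function.uncurry L) 2 (volume.prod volume)) :
    ‖kerCLM L hL‖ ≤ (eLpNorm (Function.uncurry L) 2 (volume.prod volume)).toReal :=
  LinearMap.mkContinuous_norm_le _ ENNReal.toReal_nonneg _

theorem kerOp_ae_eq (hL : MemLp (Function.uncurry L) 2 (volume.prod volume)) {f : T → ℝ}
    {F : L2 T} (hf : f =ᵐ[volume] F) : kerOp L f =ᵐ[volume] kerCLM L hL F := by
  rw [kerOp_congr L hf]
  exact (MemLp.coeFn_toLp (memLp_kerOp hL (Lp.memLp F))).symm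

theorem kerOp_iterate_ae_eq (hL : MemLp (Function.uncurry L) 2 (volume.prod volume)) {f : T → ℝ}
    {F : L2 T} (hf : f =ᵐ[volume] F) (j : ℕ) :
    (kerOp L)^[j] f =ᵐ[volume] ((kerCLM L hL)^[j] F : L2 T) := by
  induction j with
  | zero => exact hf
  | succ j ih =>
    rw [Function.iterate_succ_apply', Function.iterate_succ_apply']
    exact kerOp_ae_eq hL ih

theorem kerNorm_eq (hL : MemLp (Function.uncurry L) 2 (volume.prod volume)) :
    kerNorm L = (eLpNorm (Function.uncurry L) 2 (volume.prod volume)).toReal := by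
  have h1 : ∫ s, ∫ t, L s t ^ 2
      = (eLpNorm (Function.uncurry L) 2 (volume.prod volume)).toReal ^ 2 := by
    rw [← ENNReal.toReal_pow, eLpNorm_two_sq]
    have h2 := integral_prod (fun q : T × T => L q.1 q.2 ^ 2) hL.integrable_sq
    rw [← h2]
    refine (integral_eq_lintegral_of_nonneg_ae (ae_of_all _ fun _ => sq_nonneg _)
      hL.integrable_sq.aestronglyMeasurable).trans ?_
    congr 1
    refine lintegral_congr fun q => ?_
    rw [← Real.enorm_of_nonneg (sq_nonneg _), enorm_pow]
  rw [kerNorm, h1, Real.sqrt_sq ENNReal.toReal_nonneg]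

end KernelOperators

/-! ### Second moments of normalized sums -/

section Moments

open scoped ENNReal

variable {Ω : Type*} [MeasurableSpace Ω] {P : Measure Ω} [IsProbabilityMeasure P]

theorem enorm_integral_sq_le {f : Ω → ℝ} (hf : AEStronglyMeasurable f P) :
    ‖∫ ω, f ω ∂P‖ₑ ^ 2 ≤ ∫⁻ ω, ‖f ω‖ₑ ^ 2 ∂P := by
  have h := enorm_integral_mul_le hf (aestronglyMeasurable_const (b := (1 : ℝ)))
  have h1 : eLpNorm (fun _ : Ω => (1 : ℝ)) 2 P = 1 := by
    rw [eLpNorm_const _ (by norm_num) (IsProbabilityMeasure.ne_zero P)]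
    simp
  rw [h1, mul_one] at h
  simp only [mul_one] at h
  rw [← eLpNorm_two_sq]
  exact pow_le_pow_left' h 2

/-- A normalized centered sum of pairwise independent copies of `W₀` has at most the second moment
of `W₀`. -/
theorem lintegral_normalized_sum_sq_le {W : ℕ → Ω → ℝ} {W₀ : Ω → ℝ}
    (hident : ∀ i, IdentDistrib (W i) W₀ P P) (hindep : ∀ i j, i ≠ j → IndepFun (W i) (W j) P)
    (n : ℕ) :
    ∫⁻ ω, ‖(√(n : ℝ))⁻¹ * ∑ i ∈ Finset.range n, (W i ω - ∫ ω', W i ω' ∂P)‖ₑ ^ 2 ∂P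
      ≤ ∫⁻ ω, ‖W₀ ω‖ₑ ^ 2 ∂P := by
  rcases Nat.eq_zero_or_pos n with rfl | hn
  · simp
  by_cases hfin : ∫⁻ ω, ‖W₀ ω‖ₑ ^ 2 ∂P < ∞
  swap
  · rw [not_lt, top_le_iff] at hfin
    rw [hfin]
    exact le_top
  have hm0 : AEStronglyMeasurable W₀ P := (hident 0).aemeasurable_snd.aestronglyMeasurable
  have hL0 : MemLp W₀ 2 P := memLp_two_of_lintegral_sq_lt_top hm0 hfin
  have hL : ∀ i, MemLp (W i) 2 P := fun i => (hident i).memLp_iff.2 hL0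
  have hLs : MemLp (∑ i ∈ Finset.range n, W i) 2 P := memLp_finsetSum' _ fun i _ => hL i
  have hsum : ∫ ω, (∑ i ∈ Finset.range n, W i) ω ∂P
      = ∑ i ∈ Finset.range n, ∫ ω, W i ω ∂P := by
    simp only [Finset.sum_apply]
    exact integral_finsetSum _ fun i _ => (hL i).integrable (by norm_num)
  have h1 : ∫⁻ ω, ‖(√(n : ℝ))⁻¹ * ∑ i ∈ Finset.range n, (W i ω - ∫ ω', W i ω' ∂P)‖ₑ ^ 2 ∂P
      = ‖(√(n : ℝ))⁻¹‖ₑ ^ 2 * evariance (∑ i ∈ Finset.range n, W i) P := by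
    rw [evariance, ← lintegral_const_mul'' _ (by
      exact ((hLs.aestronglyMeasurable.sub aestronglyMeasurable_const).enorm).pow_const 2)]
    refine lintegral_congr fun ω => ?_
    rw [hsum, enorm_mul, mul_pow, Finset.sum_apply, Finset.sum_sub_distrib]
  have h2 : variance (∑ i ∈ Finset.range n, W i) P = n * variance W₀ P := by
    rw [IndepFun.variance_sum (fun i _ => hL i) fun i _ j _ hij => hindep i j hij,
      Finset.sum_congr rfl fun i _ => (hident i).variance_eq]
    simp
  have h3 : ENNReal.ofReal (variance W₀ P) ≤ ∫⁻ ω, ‖W₀ ω‖ₑ ^ 2 ∂P := by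
    refine (ENNReal.ofReal_le_ofReal (variance_le_expectation_sq hm0)).trans ?_
    refine (ofReal_integral_eq_lintegral_ofReal hL0.integrable_sq (ae_of_all _ fun _ =>
      sq_nonneg _)).le.trans ?_
    refine lintegral_mono fun ω => ?_
    rw [← enorm_pow, Real.enorm_of_nonneg (sq_nonneg _)]
  have h4 : ‖(√(n : ℝ))⁻¹‖ₑ ^ 2 = ENNReal.ofReal ((n : ℝ)⁻¹) := by
    rw [← enorm_pow, inv_pow, Real.sq_sqrt (Nat.cast_nonneg n),
      Real.enorm_of_nonneg (by positivity)]
  rw [h1, ← hLs.ofReal_variance_eq, h2, h4, ← ENNReal.ofReal_mul (by positivity), ← mul_assoc,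
    inv_mul_cancel₀ (by positivity), one_mul]
  exact h3

variable {S : Type*} [MeasurableSpace S] {ν : Measure S} [SFinite ν]

theorem lintegral_enorm_integral_sq_le {W : Ω → S → ℝ}
    (hW : AEStronglyMeasurable (Function.uncurry W) (P.prod ν)) :
    ∫⁻ s, ‖∫ ω, W ω s ∂P‖ₑ ^ 2 ∂ν ≤ ∫⁻ ω, ∫⁻ s, ‖W ω s‖ₑ ^ 2 ∂ν ∂P := by
  rw [lintegral_lintegral_swap (hW.enorm.pow_const 2)]
  refine lintegral_mono_ae ?_
  filter_upwards [hW.prod_swap.prodMk_left] with s hs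
  exact enorm_integral_sq_le hs

theorem aestronglyMeasurable_normalized_sum {W : ℕ → Ω → S → ℝ}
    (hW : ∀ i, AEStronglyMeasurable (Function.uncurry (W i)) (P.prod ν)) (n : ℕ) :
    AEStronglyMeasurable (Function.uncurry fun ω s => (√(n : ℝ))⁻¹ *
      ∑ i ∈ Finset.range n, (W i ω s - ∫ ω', W i ω' s ∂P)) (P.prod ν) := by
  refine AEStronglyMeasurable.const_mul ?_ _
  refine Finset.aestronglyMeasurable_fun_sum _ fun i _ => ?_
  have h1 : AEStronglyMeasurable (fun s => ∫ ω', W i ω' s ∂P) ν :=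
    (hW i).prod_swap.integral_prod_right'
  exact (hW i).sub h1.comp_snd

/-- The version of `lintegral_normalized_sum_sq_le` for random functions. Only the laws of the
values at each single argument enter. -/
theorem lintegral_lintegral_normalized_sum_sq_le {W : ℕ → Ω → S → ℝ} {W₀ : Ω → S → ℝ}
    (hW : ∀ i, AEStronglyMeasurable (Function.uncurry (W i)) (P.prod ν))
    (hW₀ : AEStronglyMeasurable (Function.uncurry W₀) (P.prod ν))
    (hident : ∀ i s, IdentDistrib (fun ω => W i ω s) (fun ω => W₀ ω s) P P)
    (hindep : ∀ i j s, i ≠ j → IndepFun (fun ω => W i ω s) (fun ω => W j ω s) P) (n : ℕ) :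
    ∫⁻ ω, ∫⁻ s, ‖(√(n : ℝ))⁻¹ *
        ∑ i ∈ Finset.range n, (W i ω s - ∫ ω', W i ω' s ∂P)‖ₑ ^ 2 ∂ν ∂P
      ≤ ∫⁻ ω, ∫⁻ s, ‖W₀ ω s‖ₑ ^ 2 ∂ν ∂P := by
  have h := lintegral_lintegral_swap (f := fun ω s => ‖W₀ ω s‖ₑ ^ 2) (hW₀.enorm.pow_const 2)
  rw [lintegral_lintegral_swap ((aestronglyMeasurable_normalized_sum hW n).enorm.pow_const 2), h]
  exact lintegral_mono fun s => lintegral_normalized_sum_sq_le (fun i => hident i s)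
    (fun i j hij => hindep i j s hij) n

end Moments

/-! ### The covariance operator of the random function -/

section CovarianceOperator

open scoped ENNReal RealInnerProductSpace

variable {Ω : Type*} [MeasurableSpace Ω]

/-- The centered random function `X - EX`. -/
noncomputable def centered {T : Type*} (P : Measure Ω) (X : Ω → T → ℝ) (ω : Ω) (t : T) : ℝ :=
  X ω t - meanFun P X t

theorem covFun_eq {T : Type*} (P : Measure Ω) (X : Ω → T → ℝ) (s t : T) :
    covFun P X s t = ∫ ω, centered P X ω s * centered P X ω t ∂P := rfl

variable {T : Type*} [MeasureSpace T] {P : Measure Ω} {X : Ω → T → ℝ}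
  [IsProbabilityMeasure P]

theorem measurable_meanFun (hX : Measurable fun q : Ω × T => X q.1 q.2) :
    Measurable (meanFun P X) :=
  (hX.stronglyMeasurable.integral_prod_left' (μ := P)).measurable

theorem measurable_centered (hX : Measurable fun q : Ω × T => X q.1 q.2) :
    Measurable fun q : Ω × T => centered P X q.1 q.2 :=
  hX.sub ((measurable_meanFun hX).comp measurable_snd)

theorem measurable_covFun [SFinite (volume : Measure T)]
    (hX : Measurable fun q : Ω × T => X q.1 q.2) :
    Measurable (Function.uncurry (covFun P X)) := by
  have h : Measurable fun q : Ω × (T × T) =>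
      centered P X q.1 q.2.1 * centered P X q.1 q.2.2 :=
    ((measurable_centered hX).comp (measurable_fst.prodMk (measurable_fst.comp measurable_snd))).mul
      ((measurable_centered hX).comp
        (measurable_fst.prodMk (measurable_snd.comp measurable_snd)))
  exact (h.stronglyMeasurable.integral_prod_left' (μ := P)).measurable

theorem ennreal_add_pow_four_le (x y : ℝ≥0∞) : (x + y) ^ 4 ≤ 8 * (x ^ 4 + y ^ 4) := by
  have h := ENNReal.rpow_add_le_mul_rpow_add_rpow x y (p := 4) (by norm_num)
  have h2 : (2 : ℝ≥0∞) ^ ((4 : ℝ) - 1) = 8 := by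
    rw [show (4 : ℝ) - 1 = ((3 : ℕ) : ℝ) by norm_num, ENNReal.rpow_natCast]
    norm_num
  rw [h2] at h
  exact_mod_cast h

theorem ennreal_add_sq_le (x y : ℝ≥0∞) : (x + y) ^ 2 ≤ 2 * (x ^ 2 + y ^ 2) := by
  have h := ENNReal.rpow_add_le_mul_rpow_add_rpow x y (p := 2) (by norm_num)
  have h2 : (2 : ℝ≥0∞) ^ ((2 : ℝ) - 1) = 2 := by
    rw [show (2 : ℝ) - 1 = ((1 : ℕ) : ℝ) by norm_num, ENNReal.rpow_natCast]
    norm_num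
  rw [h2] at h
  exact_mod_cast h

theorem ennreal_sq_le_one_add_pow_four (x : ℝ≥0∞) : x ^ 2 ≤ 1 + x ^ 4 := by
  rcases le_total x 1 with h | h
  · exact (pow_le_one' h 2).trans le_self_add
  · exact (pow_le_pow_right' h (by norm_num)).trans le_add_self

theorem lintegral_sq_lt_top_of_pow_four {f : Ω → ℝ≥0∞}
    (h : ∫⁻ ω, f ω ^ 4 ∂P < ∞) : ∫⁻ ω, f ω ^ 2 ∂P < ∞ := by
  refine (lintegral_mono fun ω => ennreal_sq_le_one_add_pow_four (f ω)).trans_lt ?_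
  rw [lintegral_add_left measurable_const]
  simpa using h

theorem eLpNorm_centered_le (hX : Measurable fun q : Ω × T => X q.1 q.2) (ω : Ω) :
    eLpNorm (centered P X ω) 2 volume
      ≤ eLpNorm (X ω) 2 volume + eLpNorm (meanFun P X) 2 volume :=
  eLpNorm_sub_le (hX.comp measurable_prodMk_left).aestronglyMeasurable
    (measurable_meanFun hX).aestronglyMeasurable (by norm_num)

variable [SFinite (volume : Measure T)]

theorem memLp_prod_of_lintegral_eLpNorm_sq {P : Measure Ω} {Z : Ω → T → ℝ}
    (hZ : Measurable fun q : Ω × T => Z q.1 q.2)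
    (h : ∫⁻ ω, eLpNorm (Z ω) 2 volume ^ 2 ∂P < ∞) :
    MemLp (fun q : Ω × T => Z q.1 q.2) 2 (P.prod volume) := by
  refine memLp_two_of_lintegral_sq_lt_top hZ.aestronglyMeasurable ?_
  rw [lintegral_prod _ (hZ.enorm.pow_const 2).aemeasurable]
  simpa only [← eLpNorm_two_sq] using h

theorem measurable_eLpNorm_two {Z : Ω → T → ℝ}
    (hZ : Measurable fun q : Ω × T => Z q.1 q.2) : Measurable fun ω => eLpNorm (Z ω) 2 volume := by
  have h : Measurable fun ω => ∫⁻ t, ‖Z ω t‖ₑ ^ 2 := (hZ.enorm.pow_const 2).lintegral_prod_right'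
  have h2 : (fun ω => eLpNorm (Z ω) 2 volume) = fun ω => (∫⁻ t, ‖Z ω t‖ₑ ^ 2) ^ (2⁻¹ : ℝ) := by
    funext ω
    rw [← eLpNorm_two_sq, ← ENNReal.rpow_natCast, ← ENNReal.rpow_mul]
    simp
  rw [h2]
  exact h.pow_const _

theorem memLp_meanFun (hX : Measurable fun q : Ω × T => X q.1 q.2)
    (hX4 : ∫⁻ ω, eLpNorm (X ω) 2 volume ^ 4 ∂P < ∞) : MemLp (meanFun P X) 2 volume := by
  refine memLp_two_of_lintegral_sq_lt_top (measurable_meanFun hX).aestronglyMeasurable ?_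
  refine (lintegral_enorm_integral_sq_le (P := P) (ν := volume) (W := X)
    hX.aestronglyMeasurable).trans_lt ?_
  simpa only [← eLpNorm_two_sq] using lintegral_sq_lt_top_of_pow_four hX4

theorem lintegral_centered_pow_four_lt_top (hX : Measurable fun q : Ω × T => X q.1 q.2)
    (hX4 : ∫⁻ ω, eLpNorm (X ω) 2 volume ^ 4 ∂P < ∞) :
    ∫⁻ ω, eLpNorm (centered P X ω) 2 volume ^ 4 ∂P < ∞ := by
  calc ∫⁻ ω, eLpNorm (centered P X ω) 2 volume ^ 4 ∂P
      ≤ ∫⁻ ω, 8 * (eLpNorm (X ω) 2 volume ^ 4 + eLpNorm (meanFun P X) 2 volume ^ 4) ∂P :=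
        lintegral_mono fun ω => (pow_le_pow_left' (eLpNorm_centered_le hX ω) 4).trans
          (ennreal_add_pow_four_le _ _)
    _ = 8 * (∫⁻ ω, eLpNorm (X ω) 2 volume ^ 4 ∂P + eLpNorm (meanFun P X) 2 volume ^ 4) := by
        rw [lintegral_const_mul' _ _ (by norm_num), lintegral_add_right _ measurable_const]
        simp
    _ < ∞ := ENNReal.mul_lt_top (by norm_num) (ENNReal.add_lt_top.2
        ⟨hX4, ENNReal.pow_lt_top (memLp_meanFun hX hX4).eLpNorm_lt_top⟩)

theorem lintegral_centered_sq_lt_top (hX : Measurable fun q : Ω × T => X q.1 q.2)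
    (hX4 : ∫⁻ ω, eLpNorm (X ω) 2 volume ^ 4 ∂P < ∞) :
    ∫⁻ ω, eLpNorm (centered P X ω) 2 volume ^ 2 ∂P < ∞ :=
  lintegral_sq_lt_top_of_pow_four (lintegral_centered_pow_four_lt_top hX hX4)

theorem lintegral_prod_mul_self (z : T → ℝ) (hz : AEStronglyMeasurable z volume) :
    ∫⁻ q : T × T, ‖z q.1 * z q.2‖ₑ ^ 2 ∂(volume.prod volume) = eLpNorm z 2 volume ^ 4 := by
  have h := lintegral_prod_mul (μ := (volume : Measure T)) (ν := (volume : Measure T))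
    (hz.enorm.pow_const 2) (hz.enorm.pow_const 2)
  simp only [enorm_mul, mul_pow]
  rw [h, ← eLpNorm_two_sq]
  ring

theorem memLp_covFun (hX : Measurable fun q : Ω × T => X q.1 q.2)
    (hX4 : ∫⁻ ω, eLpNorm (X ω) 2 volume ^ 4 ∂P < ∞) :
    MemLp (Function.uncurry (covFun P X)) 2 (volume.prod volume) := by
  have hm : Measurable fun q : Ω × (T × T) =>
      centered P X q.1 q.2.1 * centered P X q.1 q.2.2 :=
    ((measurable_centered hX).comp (measurable_fst.prodMk (measurable_fst.comp measurable_snd))).mul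
      ((measurable_centered hX).comp
        (measurable_fst.prodMk (measurable_snd.comp measurable_snd)))
  refine memLp_two_of_lintegral_sq_lt_top (measurable_covFun hX).aestronglyMeasurable ?_
  refine (lintegral_enorm_integral_sq_le (P := P) (ν := volume.prod volume)
    (W := fun ω (q : T × T) => centered P X ω q.1 * centered P X ω q.2)
    hm.aestronglyMeasurable).trans_lt ?_
  rw [lintegral_congr fun ω => lintegral_prod_mul_self (centered P X ω)
    ((measurable_centered hX).comp measurable_prodMk_left).aestronglyMeasurable]
  exact lintegral_centered_pow_four_lt_top hX hX4

theorem memLp_centered_prod (hX : Measurable fun q : Ω × T => X q.1 q.2)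
    (hX4 : ∫⁻ ω, eLpNorm (X ω) 2 volume ^ 4 ∂P < ∞) :
    MemLp (fun q : Ω × T => centered P X q.1 q.2) 2 (P.prod volume) :=
  memLp_prod_of_lintegral_eLpNorm_sq (measurable_centered hX)
    (lintegral_centered_sq_lt_top hX hX4)

theorem ae_memLp_centered (hX : Measurable fun q : Ω × T => X q.1 q.2)
    (hX4 : ∫⁻ ω, eLpNorm (X ω) 2 volume ^ 4 ∂P < ∞) :
    ∀ᵐ ω ∂P, MemLp (centered P X ω) 2 volume := by
  have h := ae_lt_top ((measurable_eLpNorm_two (measurable_centered (P := P) hX)).pow_const 2)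
    (lintegral_centered_sq_lt_top hX hX4).ne
  filter_upwards [h] with ω hω
  refine memLp_two_of_lintegral_sq_lt_top
    ((measurable_centered hX).comp measurable_prodMk_left).aestronglyMeasurable ?_
  rwa [← eLpNorm_two_sq]

theorem ae_memLp_centered_apply (hX : Measurable fun q : Ω × T => X q.1 q.2)
    (hX4 : ∫⁻ ω, eLpNorm (X ω) 2 volume ^ 4 ∂P < ∞) :
    ∀ᵐ t, MemLp (fun ω => centered P X ω t) 2 P := by
  have hZ := measurable_centered (P := P) hX
  have h1 := (memLp_centered_prod hX hX4).eLpNorm_lt_top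
  have h2 : eLpNorm (fun q : Ω × T => centered P X q.1 q.2) 2 (P.prod volume) ^ 2 < ∞ :=
    ENNReal.pow_lt_top h1
  rw [eLpNorm_two_sq, lintegral_prod_symm _ (hZ.enorm.pow_const 2).aemeasurable] at h2
  have h3 : Measurable fun t => ∫⁻ ω, ‖centered P X ω t‖ₑ ^ 2 ∂P :=
    (hZ.enorm.pow_const 2).lintegral_prod_left'
  filter_upwards [ae_lt_top h3 h2.ne] with t ht
  exact memLp_two_of_lintegral_sq_lt_top
    (hZ.comp measurable_prodMk_right).aestronglyMeasurable ht

/-- The score `∫ f (X - EX)` has a finite second moment. -/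
theorem memLp_score (hX : Measurable fun q : Ω × T => X q.1 q.2)
    (hX4 : ∫⁻ ω, eLpNorm (X ω) 2 volume ^ 4 ∂P < ∞) {f : T → ℝ} (hf : MemLp f 2 volume) :
    MemLp (fun ω => ∫ s, f s * centered P X ω s) 2 P := by
  have hZ := measurable_centered (P := P) hX
  have hm : AEStronglyMeasurable (fun q : Ω × T => f q.2 * centered P X q.1 q.2)
      (P.prod volume) := hf.aestronglyMeasurable.comp_snd.mul hZ.aestronglyMeasurable
  refine memLp_two_of_lintegral_sq_lt_top hm.integral_prod_right' ?_
  calc ∫⁻ ω, ‖∫ s, f s * centered P X ω s‖ₑ ^ 2 ∂P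
      ≤ ∫⁻ ω, eLpNorm f 2 volume ^ 2 * eLpNorm (centered P X ω) 2 volume ^ 2 ∂P :=
        lintegral_mono fun ω => by
          rw [← mul_pow]
          exact pow_le_pow_left' (enorm_integral_mul_le hf.aestronglyMeasurable
            (hZ.comp measurable_prodMk_left).aestronglyMeasurable) 2
    _ = eLpNorm f 2 volume ^ 2 * ∫⁻ ω, eLpNorm (centered P X ω) 2 volume ^ 2 ∂P :=
        lintegral_const_mul' _ _ (ENNReal.pow_ne_top hf.eLpNorm_ne_top)
    _ < ∞ := ENNReal.mul_lt_top (ENNReal.pow_lt_top hf.eLpNorm_lt_top)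
        (lintegral_centered_sq_lt_top hX hX4)

/-- `K(f)` is the covariance of `X` with the score of `f`. -/
theorem kerOp_covFun_ae_eq (hX : Measurable fun q : Ω × T => X q.1 q.2)
    (hX4 : ∫⁻ ω, eLpNorm (X ω) 2 volume ^ 4 ∂P < ∞) {f : T → ℝ} (hf : MemLp f 2 volume) :
    ∀ᵐ t, kerOp (covFun P X) f t
      = ∫ ω, centered P X ω t * (∫ s, f s * centered P X ω s) ∂P := by
  filter_upwards [ae_memLp_centered_apply hX hX4] with t ht
  have hint : Integrable (fun q : Ω × T => (centered P X q.1 t * f q.2) * centered P X q.1 q.2)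
      (P.prod volume) := (memLp_mul_prod ht hf).integrable_mul (memLp_centered_prod hX hX4)
  have h := integral_integral_swap (f := fun ω s => (centered P X ω t * f s) * centered P X ω s)
    hint
  calc kerOp (covFun P X) f t
      = ∫ s, ∫ ω, (centered P X ω t * f s) * centered P X ω s ∂P := by
        refine integral_congr_ae (ae_of_all _ fun s => ?_)
        simp only [covFun_eq]
        rw [← integral_const_mul]
        exact integral_congr_ae (ae_of_all _ fun ω => by ring)
    _ = ∫ ω, (∫ s, (centered P X ω t * f s) * centered P X ω s) ∂P := h.symm
    _ = _ := by
        refine integral_congr_ae (ae_of_all _ fun ω => ?_)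
        simp only [mul_assoc]
        exact integral_const_mul _ _

/-- The form of `K` is the covariance of the scores. -/
theorem integral_kerOp_covFun_mul (hX : Measurable fun q : Ω × T => X q.1 q.2)
    (hX4 : ∫⁻ ω, eLpNorm (X ω) 2 volume ^ 4 ∂P < ∞) {f g : T → ℝ} (hf : MemLp f 2 volume)
    (hg : MemLp g 2 volume) :
    ∫ t, kerOp (covFun P X) f t * g t
      = ∫ ω, (∫ s, f s * centered P X ω s) * (∫ s, g s * centered P X ω s) ∂P := by
  have hint : Integrable (fun q : Ω × T =>
      ((∫ s, f s * centered P X q.1 s) * g q.2) * centered P X q.1 q.2) (P.prod volume) :=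
    (memLp_mul_prod (memLp_score hX hX4 hf) hg).integrable_mul (memLp_centered_prod hX hX4)
  have h := integral_integral_swap
    (f := fun ω t => ((∫ s, f s * centered P X ω s) * g t) * centered P X ω t) hint
  calc ∫ t, kerOp (covFun P X) f t * g t
      = ∫ t, ∫ ω, ((∫ s, f s * centered P X ω s) * g t) * centered P X ω t ∂P := by
        refine integral_congr_ae ?_
        filter_upwards [kerOp_covFun_ae_eq hX hX4 hf] with t ht
        rw [ht, ← integral_mul_const]
        exact integral_congr_ae (ae_of_all _ fun ω => by ring)
    _ = ∫ ω, (∫ t, ((∫ s, f s * centered P X ω s) * g t) * centered P X ω t) ∂P := h.symm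
    _ = _ := by
        refine integral_congr_ae (ae_of_all _ fun ω => ?_)
        simp only [mul_assoc]
        exact integral_const_mul _ _

end CovarianceOperator

/-! ### The response in the functional linear model -/

section Response

open scoped ENNReal

variable {T : Type*} [MeasureSpace T]
variable {Ω : Type*} [MeasurableSpace Ω] {P : Measure Ω} [IsProbabilityMeasure P]
variable {X : Ω → T → ℝ} {Y ε : Ω → ℝ} {a : ℝ} {b : T → ℝ}

theorem comap_le (hX : Measurable fun q : Ω × T => X q.1 q.2) :
    MeasurableSpace.comap X inferInstance ≤ (inferInstance : MeasurableSpace Ω) :=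
  measurable_iff_comap_le.1 (measurable_pi_iff.2 fun _ => hX.comp measurable_prodMk_right)

theorem integral_error_eq_zero (hX : Measurable fun q : Ω × T => X q.1 q.2)
    (hcond : P[ε | MeasurableSpace.comap X inferInstance] =ᵐ[P] 0) : ∫ ω, ε ω ∂P = 0 := by
  rw [← integral_condExp (comap_le hX), integral_congr_ae hcond]
  simp

/-- The error is uncorrelated with the values of `X`. -/
theorem integral_centered_mul_error (hX : Measurable fun q : Ω × T => X q.1 q.2)
    (hcond : P[ε | MeasurableSpace.comap X inferInstance] =ᵐ[P] 0) (hε : MemLp ε 2 P) {t : T}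
    (ht : MemLp (fun ω => centered P X ω t) 2 P) : ∫ ω, centered P X ω t * ε ω ∂P = 0 := by
  have hm : StronglyMeasurable[MeasurableSpace.comap X inferInstance]
      fun ω => centered P X ω t := by
    have h1 : Measurable[MeasurableSpace.comap X inferInstance] fun ω => X ω t :=
      (measurable_pi_apply t).comp (comap_measurable X)
    exact (h1.sub_const _).stronglyMeasurable
  have h := condExp_mul_of_stronglyMeasurable_left hm (ht.integrable_mul hε)
    (hε.integrable (by norm_num))
  have h2 := integral_condExp (μ := P) (f := (fun ω => centered P X ω t) * ε) (comap_le hX)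
  rw [integral_congr_ae h] at h2
  have h3 : ∫ ω, centered P X ω t * ε ω ∂P = ∫ ω, ((fun ω => centered P X ω t) * ε) ω ∂P := rfl
  rw [h3, ← h2]
  refine integral_eq_zero_of_ae ?_
  filter_upwards [hcond] with ω hω
  simp [hω]

variable [SFinite (volume : Measure T)]

theorem integral_score_eq_zero (hX : Measurable fun q : Ω × T => X q.1 q.2)
    (hX4 : ∫⁻ ω, eLpNorm (X ω) 2 volume ^ 4 ∂P < ∞) (hb : MemLp b 2 volume) :
    ∫ ω, (∫ t, b t * centered P X ω t) ∂P = 0 := by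
  have hint : Integrable (fun q : Ω × T => ((1 : ℝ) * b q.2) * centered P X q.1 q.2)
      (P.prod volume) :=
    (memLp_mul_prod (memLp_const (1 : ℝ)) hb).integrable_mul (memLp_centered_prod hX hX4)
  simp only [one_mul] at hint
  rw [integral_integral_swap (f := fun ω t => b t * centered P X ω t) hint]
  refine integral_eq_zero_of_ae ?_
  filter_upwards [ae_memLp_centered_apply hX hX4] with t ht
  have h1 : Integrable (fun ω => X ω t) P := by
    have := (ht.integrable (by norm_num)).add (integrable_const (meanFun P X t))
    refine this.congr (ae_of_all _ fun ω => ?_)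
    simp [centered]
  rw [integral_const_mul]
  simp only [centered]
  rw [integral_sub h1 (integrable_const _)]
  simp [meanFun]

theorem response_ae_eq (hX : Measurable fun q : Ω × T => X q.1 q.2)
    (hX4 : ∫⁻ ω, eLpNorm (X ω) 2 volume ^ 4 ∂P < ∞) (hb : MemLp b 2 volume)
    (hmodel : ∀ᵐ ω ∂P, Y ω = a + (∫ t, b t * X ω t) + ε ω) :
    ∀ᵐ ω ∂P, Y ω = (a + ∫ t, b t * meanFun P X t)
      + ((∫ t, b t * centered P X ω t) + ε ω) := by
  filter_upwards [hmodel, ae_memLp_centered hX hX4] with ω h1 h2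
  have h3 : ∫ t, b t * X ω t = (∫ t, b t * centered P X ω t) + ∫ t, b t * meanFun P X t := by
    rw [← integral_add (integrable_fun_mul hb h2)
      (integrable_fun_mul hb (memLp_meanFun hX hX4))]
    refine integral_congr_ae (ae_of_all _ fun t => ?_)
    simp only [centered]
    ring
  rw [h1, h3]
  ring

theorem memLp_response (hX : Measurable fun q : Ω × T => X q.1 q.2)
    (hX4 : ∫⁻ ω, eLpNorm (X ω) 2 volume ^ 4 ∂P < ∞) (hb : MemLp b 2 volume)
    (hmodel : ∀ᵐ ω ∂P, Y ω = a + (∫ t, b t * X ω t) + ε ω) (hε : MemLp ε 2 P) :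
    MemLp Y 2 P :=
  ((memLp_const (a + ∫ t, b t * meanFun P X t)).add ((memLp_score hX hX4 hb).add hε)).ae_eq
    ((response_ae_eq hX hX4 hb hmodel).mono fun _ h => h.symm)

theorem centered_response_ae_eq (hX : Measurable fun q : Ω × T => X q.1 q.2)
    (hX4 : ∫⁻ ω, eLpNorm (X ω) 2 volume ^ 4 ∂P < ∞) (hb : MemLp b 2 volume)
    (hmodel : ∀ᵐ ω ∂P, Y ω = a + (∫ t, b t * X ω t) + ε ω) (hε : MemLp ε 2 P)
    (hcond : P[ε | MeasurableSpace.comap X inferInstance] =ᵐ[P] 0) :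
    ∀ᵐ ω ∂P, Y ω - ∫ ω', Y ω' ∂P = (∫ t, b t * centered P X ω t) + ε ω := by
  have h := response_ae_eq hX hX4 hb hmodel
  have hs := (memLp_score hX hX4 hb).integrable (by norm_num)
  have he := hε.integrable (by norm_num)
  have hse : Integrable (fun ω => (∫ t, b t * centered P X ω t) + ε ω) P := hs.add he
  have h1 : ∫ ω, Y ω ∂P = a + ∫ t, b t * meanFun P X t := by
    rw [integral_congr_ae h, integral_add (integrable_const _) hse, integral_add hs he,
      integral_score_eq_zero hX hX4 hb, integral_error_eq_zero hX hcond]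
    simp
  filter_upwards [h] with ω hω
  rw [h1, hω]
  ring

/-- The covariance function of `X` and the response is `K(b)`. -/
theorem integral_centered_mul_response (hX : Measurable fun q : Ω × T => X q.1 q.2)
    (hX4 : ∫⁻ ω, eLpNorm (X ω) 2 volume ^ 4 ∂P < ∞) (hb : MemLp b 2 volume)
    (hmodel : ∀ᵐ ω ∂P, Y ω = a + (∫ t, b t * X ω t) + ε ω) (hε : MemLp ε 2 P)
    (hcond : P[ε | MeasurableSpace.comap X inferInstance] =ᵐ[P] 0) :
    ∀ᵐ t, ∫ ω, centered P X ω t * (Y ω - ∫ ω', Y ω' ∂P) ∂P = kerOp (covFun P X) b t := by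
  filter_upwards [kerOp_covFun_ae_eq hX hX4 hb, ae_memLp_centered_apply hX hX4] with t h1 h2
  have h3 := centered_response_ae_eq hX hX4 hb hmodel hε hcond
  have h4 : ∫ ω, centered P X ω t * (Y ω - ∫ ω', Y ω' ∂P) ∂P
      = ∫ ω, (centered P X ω t * (∫ s, b s * centered P X ω s) + centered P X ω t * ε ω) ∂P := by
    refine integral_congr_ae ?_
    filter_upwards [h3] with ω hω
    rw [hω]
    ring
  rw [h4, integral_add (integrable_fun_mul h2 (memLp_score hX hX4 hb)) (integrable_fun_mul h2 hε),
    integral_centered_mul_error hX hcond hε h2, add_zero, h1]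

theorem lintegral_centered_sq_mul_response_sq_lt_top
    (hX : Measurable fun q : Ω × T => X q.1 q.2)
    (hX4 : ∫⁻ ω, eLpNorm (X ω) 2 volume ^ 4 ∂P < ∞) (hb : MemLp b 2 volume)
    (hmodel : ∀ᵐ ω ∂P, Y ω = a + (∫ t, b t * X ω t) + ε ω) (hε : MemLp ε 2 P)
    (hcond : P[ε | MeasurableSpace.comap X inferInstance] =ᵐ[P] 0)
    (hεX : ∫⁻ ω, ‖ε ω‖ₑ ^ 2 * eLpNorm (X ω) 2 volume ^ 2 ∂P < ∞) :
    ∫⁻ ω, eLpNorm (centered P X ω) 2 volume ^ 2 * ‖Y ω - ∫ ω', Y ω' ∂P‖ₑ ^ 2 ∂P < ∞ := by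
  set N : Ω → ℝ≥0∞ := fun ω => eLpNorm (centered P X ω) 2 volume with hN
  set B := eLpNorm b 2 volume with hB
  set m := eLpNorm (meanFun P X) 2 volume with hm
  have hBt : B < ∞ := hb.eLpNorm_lt_top
  have hmt : m < ∞ := (memLp_meanFun hX hX4).eLpNorm_lt_top
  have hNm : Measurable N := measurable_eLpNorm_two (measurable_centered hX)
  have hXm : Measurable fun ω => eLpNorm (X ω) 2 volume := measurable_eLpNorm_two hX
  have hεm : AEMeasurable (fun ω => ‖ε ω‖ₑ ^ 2) P := hε.aestronglyMeasurable.enorm.pow_const 2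
  have hε2 : ∫⁻ ω, ‖ε ω‖ₑ ^ 2 ∂P < ∞ := by
    rw [← eLpNorm_two_sq]
    exact ENNReal.pow_lt_top hε.eLpNorm_lt_top
  have hle : ∀ᵐ ω ∂P, N ω ^ 2 * ‖Y ω - ∫ ω', Y ω' ∂P‖ₑ ^ 2
      ≤ 2 * B ^ 2 * N ω ^ 4 + (4 * (‖ε ω‖ₑ ^ 2 * eLpNorm (X ω) 2 volume ^ 2)
        + 4 * m ^ 2 * ‖ε ω‖ₑ ^ 2) := by
    filter_upwards [centered_response_ae_eq hX hX4 hb hmodel hε hcond] with ω hω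
    rw [hω]
    have h1 : ‖(∫ t, b t * centered P X ω t) + ε ω‖ₑ ^ 2 ≤ 2 * ((B * N ω) ^ 2 + ‖ε ω‖ₑ ^ 2) := by
      refine (pow_le_pow_left' ((enorm_add_le _ _).trans (add_le_add_left ?_ _)) 2).trans
        (ennreal_add_sq_le _ _)
      exact enorm_integral_mul_le hb.aestronglyMeasurable
        ((measurable_centered hX).comp measurable_prodMk_left).aestronglyMeasurable
    have h2 : N ω ^ 2 ≤ 2 * (eLpNorm (X ω) 2 volume ^ 2 + m ^ 2) :=
      (pow_le_pow_left' (eLpNorm_centered_le hX ω) 2).trans (ennreal_add_sq_le _ _)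
    calc N ω ^ 2 * ‖(∫ t, b t * centered P X ω t) + ε ω‖ₑ ^ 2
        ≤ N ω ^ 2 * (2 * ((B * N ω) ^ 2 + ‖ε ω‖ₑ ^ 2)) := by gcongr
      _ = 2 * B ^ 2 * N ω ^ 4 + 2 * ‖ε ω‖ₑ ^ 2 * N ω ^ 2 := by ring
      _ ≤ 2 * B ^ 2 * N ω ^ 4 + 2 * ‖ε ω‖ₑ ^ 2 * (2 * (eLpNorm (X ω) 2 volume ^ 2 + m ^ 2)) := by
          gcongr
      _ = _ := by ring
  refine (lintegral_mono_ae hle).trans_lt ?_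
  have hm₂ : AEMeasurable (fun ω => 4 * (‖ε ω‖ₑ ^ 2 * eLpNorm (X ω) 2 volume ^ 2)) P :=
    (hεm.mul (hXm.pow_const 2).aemeasurable).const_mul _
  rw [lintegral_add_left ((hNm.pow_const 4).const_mul _),
    lintegral_add_left' hm₂,
    lintegral_const_mul' _ _ (ENNReal.mul_ne_top (by norm_num) (ENNReal.pow_ne_top hBt.ne)),
    lintegral_const_mul' _ _ (by norm_num),
    lintegral_const_mul' _ _ (ENNReal.mul_ne_top (by norm_num) (ENNReal.pow_ne_top hmt.ne))]
  exact ENNReal.add_lt_top.2 ⟨ENNReal.mul_lt_top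
      (ENNReal.mul_lt_top (by norm_num) (ENNReal.pow_lt_top hBt))
      (lintegral_centered_pow_four_lt_top hX hX4),
    ENNReal.add_lt_top.2 ⟨ENNReal.mul_lt_top (by norm_num) hεX,
      ENNReal.mul_lt_top (ENNReal.mul_lt_top (by norm_num) (ENNReal.pow_lt_top hmt)) hε2⟩⟩

end Response

/-! ### Stochastic bounds for the sample quantities -/

section Sample

open scoped ENNReal

variable {T Ω : Type*} [MeasurableSpace Ω] {P : Measure Ω}
variable {X : Ω → T → ℝ} {Y ε : Ω → ℝ} {a : ℝ} {b : T → ℝ}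
variable {Xs : ℕ → Ω → T → ℝ} {Ys : ℕ → Ω → ℝ}

theorem identDistrib_apply (hident : ∀ i, IdentDistrib (fun ω => (Xs i ω, Ys i ω))
    (fun ω => (X ω, Y ω)) P P) {F : (T → ℝ) × ℝ → ℝ} (hF : Measurable F) (i : ℕ) :
    IdentDistrib (fun ω => F (Xs i ω, Ys i ω)) (fun ω => F (X ω, Y ω)) P P :=
  (hident i).comp hF

theorem meanFun_eq (hident : ∀ i, IdentDistrib (fun ω => (Xs i ω, Ys i ω))
    (fun ω => (X ω, Y ω)) P P) (i : ℕ) (t : T) : ∫ ω, Xs i ω t ∂P = meanFun P X t :=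
  (identDistrib_apply hident ((measurable_pi_apply t).comp measurable_fst) i).integral_eq

theorem integral_response_eq (hident : ∀ i, IdentDistrib (fun ω => (Xs i ω, Ys i ω))
    (fun ω => (X ω, Y ω)) P P) (i : ℕ) : ∫ ω, Ys i ω ∂P = ∫ ω, Y ω ∂P :=
  (identDistrib_apply hident measurable_snd i).integral_eq

theorem indepFun_apply (hindep : iIndepFun (fun i ω => (Xs i ω, Ys i ω)) P)
    {F : (T → ℝ) × ℝ → ℝ} (hF : Measurable F) {i j : ℕ} (hij : i ≠ j) :
    IndepFun (fun ω => F (Xs i ω, Ys i ω)) (fun ω => F (Xs j ω, Ys j ω)) P :=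
  (hindep.indepFun hij).comp hF hF

theorem measurable_centered_mul (μ : T → ℝ) (q : T × T) :
    Measurable fun u : (T → ℝ) × ℝ => (u.1 q.1 - μ q.1) * (u.1 q.2 - μ q.2) :=
  (((measurable_pi_apply q.1).comp measurable_fst).sub_const _).mul
    (((measurable_pi_apply q.2).comp measurable_fst).sub_const _)

theorem measurable_centered_mul_response (μ : T → ℝ) (r : ℝ) (t : T) :
    Measurable fun u : (T → ℝ) × ℝ => (u.1 t - μ t) * (u.2 - r) :=
  (((measurable_pi_apply t).comp measurable_fst).sub_const _).mul (measurable_snd.sub_const _)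

theorem measure_not_le_le {q : Ω → ℝ≥0∞} {c : ℝ≥0∞} (hq : AEMeasurable (fun ω => q ω ^ 2) P)
    (h : ∫⁻ ω, q ω ^ 2 ∂P ≤ c) {η M : ℝ} (hM : 0 < M)
    (hc : c ≤ ENNReal.ofReal η * ENNReal.ofReal M ^ 2) :
    P {ω | ¬ q ω ≤ ENNReal.ofReal M} ≤ ENNReal.ofReal η := by
  have hM0 : ENNReal.ofReal M ^ 2 ≠ 0 := pow_ne_zero _ (by simpa using hM)
  have hMt : ENNReal.ofReal M ^ 2 ≠ ∞ := ENNReal.pow_ne_top ENNReal.ofReal_ne_top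
  calc P {ω | ¬ q ω ≤ ENNReal.ofReal M} ≤ P {ω | ENNReal.ofReal M ^ 2 ≤ q ω ^ 2} :=
        measure_mono fun ω hω => by
          rw [Set.mem_ofPred_eq] at hω ⊢
          exact pow_le_pow_left' (not_le.1 hω).le 2
    _ ≤ (∫⁻ ω, q ω ^ 2 ∂P) / ENNReal.ofReal M ^ 2 :=
        meas_ge_le_lintegral_div hq hM0 hMt
    _ ≤ ENNReal.ofReal η := ENNReal.div_le_of_le_mul (h.trans hc)

variable [MeasureSpace T]

/-- The event on which the sample mean and the random functions `ξ`, `ξ₀` are of the sizes that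
their second moments suggest, up to the factor `M`. -/
structure GoodSample (P : Measure Ω) (X : Ω → T → ℝ) (Y : Ω → ℝ) (Xs : ℕ → Ω → T → ℝ)
    (Ys : ℕ → Ω → ℝ) (M : ℝ) (n : ℕ) (ω : Ω) : Prop where
  memLp : ∀ i, MemLp (Xs i ω) 2 volume
  xi_le : eLpNorm (Function.uncurry (xi P X Xs n ω)) 2 (volume.prod volume) ≤ ENNReal.ofReal M
  xiZero_le : eLpNorm (xiZero P X Xs Ys n ω) 2 volume ≤ ENNReal.ofReal M
  mean_le : eLpNorm (fun t => (√(n : ℝ))⁻¹ *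
    ∑ i ∈ Finset.range n, (Xs i ω t - meanFun P X t)) 2 volume ≤ ENNReal.ofReal M
  response_le : ‖(√(n : ℝ))⁻¹ * ∑ i ∈ Finset.range n, (Ys i ω - ∫ ω', Y ω' ∂P)‖ₑ
    ≤ ENNReal.ofReal M

variable [SFinite (volume : Measure T)] [IsProbabilityMeasure P]

theorem ae_memLp_sample (hX : Measurable fun q : Ω × T => X q.1 q.2)
    (hX4 : ∫⁻ ω, eLpNorm (X ω) 2 volume ^ 4 ∂P < ∞)
    (hXs : ∀ i, Measurable fun q : Ω × T => Xs i q.1 q.2)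
    (hident : ∀ i, IdentDistrib (fun ω => (Xs i ω, Ys i ω)) (fun ω => (X ω, Y ω)) P P) :
    ∀ᵐ ω ∂P, ∀ i, MemLp (Xs i ω) 2 volume := by
  rw [ae_all_iff]
  intro i
  have h1 : ∫⁻ ω, ∫⁻ t, ‖Xs i ω t‖ₑ ^ 2 ∂volume ∂P = ∫⁻ ω, ∫⁻ t, ‖X ω t‖ₑ ^ 2 ∂volume ∂P := by
    have e1 := lintegral_lintegral_swap (μ := P) (ν := volume)
      (f := fun ω t => ‖Xs i ω t‖ₑ ^ 2) ((hXs i).enorm.pow_const 2).aemeasurable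
    have e2 := lintegral_lintegral_swap (μ := P) (ν := volume)
      (f := fun ω t => ‖X ω t‖ₑ ^ 2) (hX.enorm.pow_const 2).aemeasurable
    rw [e1, e2]
    refine lintegral_congr fun t => ?_
    exact ((identDistrib_apply hident ((measurable_pi_apply t).comp measurable_fst) i).comp
      (measurable_enorm.pow_const 2)).lintegral_eq
  have h2 : ∫⁻ ω, ∫⁻ t, ‖X ω t‖ₑ ^ 2 ∂volume ∂P < ∞ := by
    simpa only [← eLpNorm_two_sq] using lintegral_sq_lt_top_of_pow_four hX4
  have h3 : Measurable fun ω => ∫⁻ t, ‖Xs i ω t‖ₑ ^ 2 :=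
    ((hXs i).enorm.pow_const 2).lintegral_prod_right'
  filter_upwards [ae_lt_top h3 (h1 ▸ h2).ne] with ω hω
  exact memLp_two_of_lintegral_sq_lt_top
    ((hXs i).comp measurable_prodMk_left).aestronglyMeasurable hω

/-- `GoodSample` has probability close to `1` for large `M`, uniformly in `n`. -/
theorem exists_goodSample (hX : Measurable fun q : Ω × T => X q.1 q.2)
    (hX4 : ∫⁻ ω, eLpNorm (X ω) 2 volume ^ 4 ∂P < ∞) (hb : MemLp b 2 volume)
    (hmodel : ∀ᵐ ω ∂P, Y ω = a + (∫ t, b t * X ω t) + ε ω) (hε : MemLp ε 2 P)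
    (hcond : P[ε | MeasurableSpace.comap X inferInstance] =ᵐ[P] 0)
    (hεX : ∫⁻ ω, ‖ε ω‖ₑ ^ 2 * eLpNorm (X ω) 2 volume ^ 2 ∂P < ∞)
    (hXs : ∀ i, Measurable fun q : Ω × T => Xs i q.1 q.2)
    (hindep : iIndepFun (fun i ω => (Xs i ω, Ys i ω)) P)
    (hident : ∀ i, IdentDistrib (fun ω => (Xs i ω, Ys i ω)) (fun ω => (X ω, Y ω)) P P)
    {η : ℝ} (hη : 0 < η) :
    ∃ M, 0 < M ∧ ∀ n, P {ω | ¬ GoodSample P X Y Xs Ys M n ω} ≤ ENNReal.ofReal η := by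
  have hY : AEMeasurable Y P := (hident 0).aemeasurable_snd.snd
  have hYs : ∀ i, AEMeasurable (Ys i) P := fun i => (hident i).aemeasurable_fst.snd
  have hμ := measurable_meanFun (P := P) hX
  have hZ := measurable_centered (P := P) hX
  have hZs : ∀ i, Measurable fun q : Ω × T => Xs i q.1 q.2 - meanFun P X q.2 := fun i =>
    (hXs i).sub (hμ.comp measurable_snd)
  set e : ℝ := ∫ ω', Y ω' ∂P with he
  -- the four second moments
  set c₁ := ∫⁻ ω, eLpNorm (centered P X ω) 2 volume ^ 4 ∂P with hc₁
  set c₂ := ∫⁻ ω, eLpNorm (centered P X ω) 2 volume ^ 2 * ‖Y ω - e‖ₑ ^ 2 ∂P with hc₂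
  set c₃ := ∫⁻ ω, eLpNorm (X ω) 2 volume ^ 2 ∂P with hc₃
  set c₄ := ∫⁻ ω, ‖Y ω‖ₑ ^ 2 ∂P with hc₄
  have hc₁t : c₁ < ∞ := lintegral_centered_pow_four_lt_top hX hX4
  have hc₂t : c₂ < ∞ :=
    lintegral_centered_sq_mul_response_sq_lt_top hX hX4 hb hmodel hε hcond hεX
  have hc₃t : c₃ < ∞ := lintegral_sq_lt_top_of_pow_four hX4
  have hc₄t : c₄ < ∞ := by
    rw [hc₄, ← eLpNorm_two_sq]
    exact ENNReal.pow_lt_top (memLp_response hX hX4 hb hmodel hε).eLpNorm_lt_top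
  set c := c₁ + c₂ + c₃ + c₄ with hc
  have hct : c < ∞ := by simp [hc, ENNReal.add_lt_top, hc₁t, hc₂t, hc₃t, hc₄t]
  have l₁ : c₁ ≤ c := by rw [hc, add_assoc, add_assoc]; exact le_self_add
  have l₂ : c₂ ≤ c := by rw [hc, add_assoc, add_assoc, add_left_comm]; exact le_self_add
  have l₃ : c₃ ≤ c := by rw [hc, add_right_comm]; exact le_add_self
  have l₄ : c₄ ≤ c := le_add_self
  set M : ℝ := √(4 * (c.toReal + 1) / η) with hM
  have hM2 : M ^ 2 = 4 * (c.toReal + 1) / η := Real.sq_sqrt (by positivity)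
  have hM0 : 0 < M := Real.sqrt_pos.2 (by positivity)
  have hcM : c ≤ ENNReal.ofReal (η / 4) * ENNReal.ofReal M ^ 2 := by
    rw [← ENNReal.ofReal_pow hM0.le, ← ENNReal.ofReal_mul (by positivity), hM2,
      show η / 4 * (4 * (c.toReal + 1) / η) = c.toReal + 1 by field_simp]
    exact (ENNReal.ofReal_toReal hct.ne).symm.le.trans
      (ENNReal.ofReal_le_ofReal (by linarith))
  refine ⟨M, hM0, fun n => ?_⟩
  -- the kernel `ξ`
  have b₁ : P {ω | ¬ eLpNorm (Function.uncurry (xi P X Xs n ω)) 2 (volume.prod volume)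
      ≤ ENNReal.ofReal M} ≤ ENNReal.ofReal (η / 4) := by
    set W : ℕ → Ω → T × T → ℝ := fun i ω q =>
      (Xs i ω q.1 - meanFun P X q.1) * (Xs i ω q.2 - meanFun P X q.2) with hW
    have hWm : ∀ i, AEStronglyMeasurable (Function.uncurry (W i))
        (P.prod (volume.prod volume)) := fun i =>
      (((hZs i).comp (measurable_fst.prodMk (measurable_fst.comp measurable_snd))).mul
        ((hZs i).comp
          (measurable_fst.prodMk (measurable_snd.comp measurable_snd)))).aestronglyMeasurable
    have hW₀m : AEStronglyMeasurable (Function.uncurry fun ω (q : T × T) =>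
        centered P X ω q.1 * centered P X ω q.2) (P.prod (volume.prod volume)) :=
      ((hZ.comp (measurable_fst.prodMk (measurable_fst.comp measurable_snd))).mul
        (hZ.comp (measurable_fst.prodMk (measurable_snd.comp measurable_snd)))).aestronglyMeasurable
    have hbd := lintegral_lintegral_normalized_sum_sq_le (P := P) hWm hW₀m
      (fun i q => identDistrib_apply hident (measurable_centered_mul (meanFun P X) q) i)
      (fun i j q hij => indepFun_apply hindep (measurable_centered_mul (meanFun P X) q) hij) n
    rw [lintegral_congr fun ω => lintegral_prod_mul_self (centered P X ω)
      (hZ.comp measurable_prodMk_left).aestronglyMeasurable] at hbd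
    have hmeas : AEMeasurable (fun ω => ∫⁻ q, ‖Function.uncurry (xi P X Xs n ω) q‖ₑ ^ 2
        ∂(volume.prod volume)) P :=
      ((aestronglyMeasurable_normalized_sum hWm n).enorm.pow_const 2).lintegral_prod_right'
    refine measure_not_le_le (c := c) ?_ ?_ hM0 hcM
    · simpa only [eLpNorm_two_sq] using hmeas
    · simp only [eLpNorm_two_sq]
      exact hbd.trans l₁
  -- the function `ξ₀`
  have b₂ : P {ω | ¬ eLpNorm (xiZero P X Xs Ys n ω) 2 volume ≤ ENNReal.ofReal M}
      ≤ ENNReal.ofReal (η / 4) := by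
    set W : ℕ → Ω → T → ℝ := fun i ω t => (Xs i ω t - meanFun P X t) * (Ys i ω - e) with hW
    have hWm : ∀ i, AEStronglyMeasurable (Function.uncurry (W i)) (P.prod volume) := fun i =>
      (hZs i).aestronglyMeasurable.mul ((hYs i).sub_const e).aestronglyMeasurable.comp_fst
    have hW₀m : AEStronglyMeasurable (Function.uncurry fun ω t => centered P X ω t * (Y ω - e))
        (P.prod volume) :=
      hZ.aestronglyMeasurable.mul (hY.sub_const e).aestronglyMeasurable.comp_fst
    have hbd := lintegral_lintegral_normalized_sum_sq_le (P := P) hWm hW₀m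
      (fun i t => identDistrib_apply hident
        (measurable_centered_mul_response (meanFun P X) e t) i)
      (fun i j t hij => indepFun_apply hindep
        (measurable_centered_mul_response (meanFun P X) e t) hij) n
    have hW₀ : ∫⁻ ω, ∫⁻ t, ‖centered P X ω t * (Y ω - e)‖ₑ ^ 2 ∂volume ∂P = c₂ := by
      refine lintegral_congr fun ω => ?_
      simp only [enorm_mul, mul_pow]
      rw [lintegral_mul_const' _ _ (ENNReal.pow_ne_top enorm_ne_top), eLpNorm_two_sq]
    rw [hW₀] at hbd
    have hxi : ∀ ω t, xiZero P X Xs Ys n ω t = (√(n : ℝ))⁻¹ *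
        ∑ i ∈ Finset.range n, (W i ω t - ∫ ω', W i ω' t ∂P) := by
      intro ω t
      simp only [xiZero, hW, integral_response_eq hident, he]
    have hmeas : AEMeasurable (fun ω => ∫⁻ t, ‖xiZero P X Xs Ys n ω t‖ₑ ^ 2) P := by
      simp only [hxi]
      exact ((aestronglyMeasurable_normalized_sum hWm n).enorm.pow_const 2).lintegral_prod_right'
    refine measure_not_le_le (c := c) ?_ ?_ hM0 hcM
    · simpa only [eLpNorm_two_sq] using hmeas
    · simp only [eLpNorm_two_sq, hxi]
      exact hbd.trans l₂
  -- the sample mean of the functions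
  have b₃ : P {ω | ¬ eLpNorm (fun t => (√(n : ℝ))⁻¹ *
      ∑ i ∈ Finset.range n, (Xs i ω t - meanFun P X t)) 2 volume ≤ ENNReal.ofReal M}
      ≤ ENNReal.ofReal (η / 4) := by
    have hWm : ∀ i, AEStronglyMeasurable (Function.uncurry (Xs i)) (P.prod volume) := fun i =>
      (hXs i).aestronglyMeasurable
    have hbd := lintegral_lintegral_normalized_sum_sq_le (P := P) (ν := volume) hWm
      (W₀ := X) hX.aestronglyMeasurable
      (fun i t => identDistrib_apply hident ((measurable_pi_apply t).comp measurable_fst) i)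
      (fun i j t hij => indepFun_apply hindep
        ((measurable_pi_apply t).comp measurable_fst) hij) n
    have hmeas := ((aestronglyMeasurable_normalized_sum (P := P) hWm n).enorm.pow_const
      2).lintegral_prod_right'
    simp only [Function.uncurry, meanFun_eq hident] at hbd hmeas
    refine measure_not_le_le (c := c) ?_ ?_ hM0 hcM
    · simpa only [eLpNorm_two_sq] using hmeas
    · simp only [eLpNorm_two_sq]
      refine hbd.trans ?_
      simpa only [hc₃, eLpNorm_two_sq] using l₃
  -- the sample mean of the responses
  have b₄ : P {ω | ¬ ‖(√(n : ℝ))⁻¹ * ∑ i ∈ Finset.range n, (Ys i ω - e)‖ₑ ≤ ENNReal.ofReal M}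
      ≤ ENNReal.ofReal (η / 4) := by
    have hbd := lintegral_normalized_sum_sq_le (P := P)
      (fun i => identDistrib_apply hident measurable_snd i)
      (fun i j hij => indepFun_apply hindep measurable_snd hij) n
    simp only [integral_response_eq hident] at hbd
    refine measure_not_le_le (c := c) ?_ (hbd.trans l₄) hM0 hcM
    refine AEMeasurable.pow_const (AEMeasurable.enorm ?_) 2
    refine AEMeasurable.const_mul ?_ _
    exact Finset.aemeasurable_fun_sum _ fun i _ => (hYs i).sub_const e
  have b₀ : P {ω | ¬ ∀ i, MemLp (Xs i ω) 2 volume} = 0 := ae_memLp_sample hX hX4 hXs hident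
  have hsub : {ω | ¬ GoodSample P X Y Xs Ys M n ω} ⊆
      {ω | ¬ ∀ i, MemLp (Xs i ω) 2 volume} ∪
      ({ω | ¬ eLpNorm (Function.uncurry (xi P X Xs n ω)) 2 (volume.prod volume)
        ≤ ENNReal.ofReal M} ∪
      ({ω | ¬ eLpNorm (xiZero P X Xs Ys n ω) 2 volume ≤ ENNReal.ofReal M} ∪
      ({ω | ¬ eLpNorm (fun t => (√(n : ℝ))⁻¹ *
        ∑ i ∈ Finset.range n, (Xs i ω t - meanFun P X t)) 2 volume ≤ ENNReal.ofReal M} ∪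
      {ω | ¬ ‖(√(n : ℝ))⁻¹ * ∑ i ∈ Finset.range n, (Ys i ω - e)‖ₑ ≤ ENNReal.ofReal M}))) := by
    intro ω hω
    by_contra h
    simp only [Set.mem_union, Set.mem_ofPred_eq, not_or, not_not] at h
    exact hω ⟨h.1, h.2.1, h.2.2.1, h.2.2.2.1, h.2.2.2.2⟩
  calc P {ω | ¬ GoodSample P X Y Xs Ys M n ω}
      ≤ 0 + (ENNReal.ofReal (η / 4) + (ENNReal.ofReal (η / 4) + (ENNReal.ofReal (η / 4)
        + ENNReal.ofReal (η / 4)))) := by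
        refine (measure_mono hsub).trans ((measure_union_le _ _).trans (add_le_add b₀.le ?_))
        refine (measure_union_le _ _).trans (add_le_add b₁ ?_)
        refine (measure_union_le _ _).trans (add_le_add b₂ ?_)
        exact (measure_union_le _ _).trans (add_le_add b₃ b₄)
    _ = ENNReal.ofReal η := by
        have h4 : 0 ≤ η / 4 := by positivity
        rw [zero_add, ← ENNReal.ofReal_add h4 h4, ← ENNReal.ofReal_add h4 (by positivity),
          ← ENNReal.ofReal_add h4 (by positivity)]
        congr 1
        ring

end Sample

/-! ### The normal equations -/

section QuadraticForms

open Finset Matrix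

theorem sq_sub_sum_eq {p : ℕ} (y : ℝ) (w q : Fin p → ℝ) :
    (y - ∑ j, w j * q j) ^ 2
      = y ^ 2 - 2 * ∑ j, w j * (y * q j) + ∑ j, ∑ k, w j * w k * (q j * q k) := by
  have h1 : ∑ j, w j * (y * q j) = y * ∑ j, w j * q j := by
    rw [mul_sum]
    exact sum_congr rfl fun j _ => by ring
  have h2 : ∑ j, ∑ k, w j * w k * (q j * q k) = (∑ j, w j * q j) * ∑ j, w j * q j := by
    rw [sum_mul_sum]
    exact sum_congr rfl fun j _ => sum_congr rfl fun k _ => by ring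
  rw [h1, h2]
  ring

theorem dotProduct_mulVec_eq_sum {p : ℕ} (H : Matrix (Fin p) (Fin p) ℝ) (w : Fin p → ℝ) :
    w ⬝ᵥ H *ᵥ w = ∑ j, ∑ k, w j * w k * H j k := by
  simp only [dotProduct, mulVec, mul_sum]
  exact sum_congr rfl fun j _ => sum_congr rfl fun k _ => by ring

end QuadraticForms

section Population

open Matrix
open scoped ENNReal

variable {T : Type*} [MeasureSpace T] [SFinite (volume : Measure T)]
variable {Ω : Type*} [MeasurableSpace Ω] {P : Measure Ω} [IsProbabilityMeasure P]
variable {X : Ω → T → ℝ} {b : T → ℝ}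

theorem Kpow_succ {T Ω : Type*} [MeasureSpace T] [MeasurableSpace Ω] (P : Measure Ω)
    (X : Ω → T → ℝ) (b : T → ℝ) (j : ℕ) :
    Kpow P X b (j + 1) = kerOp (covFun P X) (Kpow P X b j) :=
  Function.iterate_succ_apply' _ _ _

theorem memLp_Kpow (hX : Measurable fun q : Ω × T => X q.1 q.2)
    (hX4 : ∫⁻ ω, eLpNorm (X ω) 2 volume ^ 4 ∂P < ∞) (hb : MemLp b 2 volume) (j : ℕ) :
    MemLp (Kpow P X b j) 2 volume := by
  induction j with
  | zero => exact hb
  | succ j ih =>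
    rw [Kpow_succ]
    exact memLp_kerOp (memLp_covFun hX hX4) ih

/-- `∫ K^{i+1}(b) K^k(b)` is the covariance of the scores of `K^i(b)` and `K^k(b)`. -/
theorem integral_Kpow_succ_mul (hX : Measurable fun q : Ω × T => X q.1 q.2)
    (hX4 : ∫⁻ ω, eLpNorm (X ω) 2 volume ^ 4 ∂P < ∞) (hb : MemLp b 2 volume) (i k : ℕ) :
    ∫ t, Kpow P X b (i + 1) t * Kpow P X b k t
      = ∫ ω, (∫ t, (X ω t - meanFun P X t) * Kpow P X b i t)
        * (∫ t, (X ω t - meanFun P X t) * Kpow P X b k t) ∂P := by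
  rw [Kpow_succ, integral_kerOp_covFun_mul hX hX4 (memLp_Kpow hX hX4 hb i)
    (memLp_Kpow hX hX4 hb k)]
  simp only [centered, mul_comm]

/-- `H` is the covariance matrix of scores, hence symmetric. -/
theorem transpose_Hmat (hX : Measurable fun q : Ω × T => X q.1 q.2)
    (hX4 : ∫⁻ ω, eLpNorm (X ω) 2 volume ^ 4 ∂P < ∞) (hb : MemLp b 2 volume) (p : ℕ) :
    (Hmat P X b p)ᵀ = Hmat P X b p := by
  ext j k
  simp only [Hmat, transpose_apply, of_apply]
  rw [integral_Kpow_succ_mul hX hX4 hb, integral_Kpow_succ_mul hX hX4 hb]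
  simp only [mul_comm]

theorem coercive_Hmat (hX : Measurable fun q : Ω × T => X q.1 q.2)
    (hX4 : ∫⁻ ω, eLpNorm (X ω) 2 volume ^ 4 ∂P < ∞) (hb : MemLp b 2 volume) (p : ℕ) :
    Coercive (Hmat P X b p) (lam P X b p) :=
  coercive_sInf_spectrum (transpose_Hmat hX hX4 hb p)

theorem tp_eq (hX : Measurable fun q : Ω × T => X q.1 q.2)
    (hX4 : ∫⁻ ω, eLpNorm (X ω) 2 volume ^ 4 ∂P < ∞) (hb : MemLp b 2 volume) (p : ℕ)
    (w : Fin p → ℝ) :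
    tp P X b p w = tp P X b p 0
      - 2 * (w ⬝ᵥ fun k : Fin p => ∫ t, Kpow P X b 1 t * Kpow P X b (k + 1) t)
      + w ⬝ᵥ Hmat P X b p *ᵥ w := by
  set q : ℕ → Ω → ℝ := fun j ω => ∫ t, (X ω t - meanFun P X t) * Kpow P X b j t with hq
  have hqL : ∀ j, MemLp (q j) 2 P := fun j => by
    have := memLp_score hX hX4 (memLp_Kpow hX hX4 hb j)
    simpa only [hq, centered, mul_comm] using this
  have hint : ∀ i j, Integrable (fun ω => q i ω * q j ω) P := fun i j =>
    integrable_fun_mul (hqL i) (hqL j)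
  have h0 : ∀ v, tp P X b p v = ∫ ω, (q 0 ω - ∑ j : Fin p, v j * q (j + 1) ω) ^ 2 ∂P :=
    fun v => rfl
  rw [h0, h0, dotProduct_mulVec_eq_sum]
  simp only [sq_sub_sum_eq, Pi.zero_apply, zero_mul, Finset.sum_const_zero, sub_zero,
    dotProduct, Hmat, of_apply, integral_Kpow_succ_mul hX hX4 hb]
  have i0 : Integrable (fun ω => q 0 ω ^ 2) P := (hqL 0).integrable_sq
  have i1 : Integrable (fun ω => 2 * ∑ j : Fin p, w j * (q 0 ω * q (j + 1) ω)) P :=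
    (integrable_finsetSum _ fun j _ => (hint _ _).const_mul _).const_mul _
  have i2 : Integrable (fun ω => ∑ j : Fin p, ∑ k : Fin p,
      w j * w k * (q (j + 1) ω * q (k + 1) ω)) P :=
    integrable_finsetSum _ fun j _ => integrable_finsetSum _ fun k _ => (hint _ _).const_mul _
  have i01 : Integrable (fun ω => q 0 ω ^ 2
      - 2 * ∑ j : Fin p, w j * (q 0 ω * q (j + 1) ω)) P := i0.sub i1
  rw [integral_add i01 i2, integral_sub i0 i1, integral_const_mul,
    integral_finsetSum _ fun j _ => (hint _ _).const_mul _,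
    integral_finsetSum _ fun j _ => integrable_finsetSum _ fun k _ => (hint _ _).const_mul _]
  congr 1
  · congr 2
    refine Finset.sum_congr rfl fun j _ => ?_
    exact integral_const_mul _ _
  · refine Finset.sum_congr rfl fun j _ => ?_
    rw [integral_finsetSum _ fun k _ => (hint _ _).const_mul _]
    exact Finset.sum_congr rfl fun k _ => integral_const_mul _ _

/-- The normal equations of the population coefficients. -/
theorem Hmat_mulVec_gam (hX : Measurable fun q : Ω × T => X q.1 q.2)
    (hX4 : ∫⁻ ω, eLpNorm (X ω) 2 volume ^ 4 ∂P < ∞) (hb : MemLp b 2 volume) {p : ℕ}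
    (hl : 0 < lam P X b p) :
    Hmat P X b p *ᵥ gam P X b p
      = fun k : Fin p => ∫ t, Kpow P X b 1 t * Kpow P X b (k + 1) t :=
  mulVec_argmin hl (transpose_Hmat hX hX4 hb p) (coercive_Hmat hX hX4 hb p)
    (tp_eq hX hX4 hb p)

end Population

section Empirical

open Matrix Finset
open scoped ENNReal

variable {T Ω : Type*} [MeasureSpace T]
variable {Xs : ℕ → Ω → T → ℝ} {Ys : ℕ → Ω → ℝ} {n : ℕ} {ω : Ω}

theorem KpowHat_succ (Xs : ℕ → Ω → T → ℝ) (Ys : ℕ → Ω → ℝ) (n : ℕ) (ω : Ω) (j : ℕ) :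
    KpowHat Xs Ys n ω (j + 2) = kerOp (covHat Xs n ω) (KpowHat Xs Ys n ω (j + 1)) :=
  Function.iterate_succ_apply' _ _ _

theorem memLp_sub_xBar (h : ∀ i, MemLp (Xs i ω) 2 volume) (i : ℕ) :
    MemLp (fun t => Xs i ω t - xBar Xs n ω t) 2 volume :=
  (h i).sub ((memLp_finsetSum _ fun i _ => h i).const_mul _)

/-- The empirical covariance transformation has finite rank. -/
theorem kerOp_covHat_apply (h : ∀ i, MemLp (Xs i ω) 2 volume) {f : T → ℝ}
    (hf : MemLp f 2 volume) (t : T) :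
    kerOp (covHat Xs n ω) f t = (n : ℝ)⁻¹ * ∑ i ∈ range n,
      (∫ s, (Xs i ω s - xBar Xs n ω s) * f s) * (Xs i ω t - xBar Xs n ω t) := by
  have hint : ∀ i, Integrable (fun s => (Xs i ω s - xBar Xs n ω s) * f s) volume := fun i =>
    integrable_fun_mul (memLp_sub_xBar h i) hf
  calc kerOp (covHat Xs n ω) f t
      = ∫ s, (n : ℝ)⁻¹ * ∑ i ∈ range n,
        ((Xs i ω s - xBar Xs n ω s) * f s) * (Xs i ω t - xBar Xs n ω t) := by
        refine integral_congr_ae (ae_of_all _ fun s => ?_)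
        simp only [covHat, mul_sum]
        exact sum_congr rfl fun i _ => by ring
    _ = _ := by
        rw [integral_const_mul, integral_finsetSum _ fun i _ => (hint i).mul_const _]
        exact congrArg _ (sum_congr rfl fun i _ => integral_mul_const _ _)

theorem integral_kerOp_covHat_mul (h : ∀ i, MemLp (Xs i ω) 2 volume) {f g : T → ℝ}
    (hf : MemLp f 2 volume) (hg : MemLp g 2 volume) :
    ∫ t, kerOp (covHat Xs n ω) f t * g t = (n : ℝ)⁻¹ * ∑ i ∈ range n,
      (∫ s, (Xs i ω s - xBar Xs n ω s) * f s) * (∫ s, (Xs i ω s - xBar Xs n ω s) * g s) := by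
  have hint : ∀ i, Integrable (fun s => (Xs i ω s - xBar Xs n ω s) * g s) volume := fun i =>
    integrable_fun_mul (memLp_sub_xBar h i) hg
  simp only [kerOp_covHat_apply h hf, mul_assoc, sum_mul]
  rw [integral_const_mul, integral_finsetSum _ fun i _ => (hint i).const_mul _]
  exact congrArg _ (sum_congr rfl fun i _ => integral_const_mul _ _)

theorem integral_KbHat_mul (h : ∀ i, MemLp (Xs i ω) 2 volume) {g : T → ℝ}
    (hg : MemLp g 2 volume) :
    ∫ t, KbHat Xs Ys n ω t * g t = (n : ℝ)⁻¹ * ∑ i ∈ range n,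
      (Ys i ω - yBar Ys n ω) * (∫ s, (Xs i ω s - xBar Xs n ω s) * g s) := by
  have hint : ∀ i, Integrable (fun s => (Xs i ω s - xBar Xs n ω s) * g s) volume := fun i =>
    integrable_fun_mul (memLp_sub_xBar h i) hg
  calc ∫ t, KbHat Xs Ys n ω t * g t
      = ∫ t, (n : ℝ)⁻¹ * ∑ i ∈ range n,
        (Ys i ω - yBar Ys n ω) * ((Xs i ω t - xBar Xs n ω t) * g t) := by
        refine integral_congr_ae (ae_of_all _ fun s => ?_)
        simp only [KbHat, mul_assoc, sum_mul]
        exact congrArg _ (sum_congr rfl fun i _ => by ring)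
    _ = _ := by
        rw [integral_const_mul, integral_finsetSum _ fun i _ => (hint i).const_mul _]
        exact congrArg _ (sum_congr rfl fun i _ => integral_const_mul _ _)

theorem Up_eq (h : ∀ i, MemLp (Xs i ω) 2 volume)
    (hK : ∀ j, MemLp (KpowHat Xs Ys n ω (j + 1)) 2 volume) (p : ℕ) (w : Fin p → ℝ) :
    Up Xs Ys n ω p w = Up Xs Ys n ω p 0
      - 2 * (w ⬝ᵥ fun k : Fin p => ∫ t, KpowHat Xs Ys n ω 1 t * KpowHat Xs Ys n ω (k + 1) t)
      + w ⬝ᵥ (Matrix.of fun j k : Fin p =>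
        ∫ t, KpowHat Xs Ys n ω (j + 2) t * KpowHat Xs Ys n ω (k + 1) t) *ᵥ w := by
  have h1 : KpowHat Xs Ys n ω 1 = KbHat Xs Ys n ω := rfl
  rw [dotProduct_mulVec_eq_sum]
  simp only [of_apply, KpowHat_succ, integral_kerOp_covHat_mul h (hK _) (hK _), h1,
    integral_KbHat_mul h (hK _), Up, sq_sub_sum_eq, Pi.zero_apply, zero_mul,
    sum_const_zero, sub_zero, dotProduct, sum_add_distrib, sum_sub_distrib,
    mul_add, mul_sub]
  congr 1
  · congr 1
    rw [← mul_sum, sum_comm]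
    simp only [mul_sum]
    exact sum_congr rfl fun j _ => sum_congr rfl fun i _ => by ring
  · rw [sum_comm]
    simp only [mul_sum]
    refine sum_congr rfl fun j _ => ?_
    rw [sum_comm]
    exact sum_congr rfl fun k _ => sum_congr rfl fun i _ => by ring

/-- The normal equations of the empirical coefficients. -/
theorem mulVec_gamHat (h : ∀ i, MemLp (Xs i ω) 2 volume)
    (hK : ∀ j, MemLp (KpowHat Xs Ys n ω (j + 1)) 2 volume) {p : ℕ} {l : ℝ} (hl : 0 < l)
    (hcoer : Coercive (Matrix.of fun j k : Fin p =>
      ∫ t, KpowHat Xs Ys n ω (j + 2) t * KpowHat Xs Ys n ω (k + 1) t) l) :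
    (Matrix.of fun j k : Fin p =>
      ∫ t, KpowHat Xs Ys n ω (j + 2) t * KpowHat Xs Ys n ω (k + 1) t) *ᵥ gamHat Xs Ys n ω p
      = fun k : Fin p => ∫ t, KpowHat Xs Ys n ω 1 t * KpowHat Xs Ys n ω (k + 1) t := by
  refine mulVec_argmin hl ?_ hcoer (Up_eq h hK p)
  ext j k
  simp only [transpose_apply, of_apply, KpowHat_succ, integral_kerOp_covHat_mul h (hK _) (hK _)]
  simp only [mul_comm]

end Empirical

/-! ### The sample quantities as a perturbation of the population quantities -/

section Bridge

open Finset Matrix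
open scoped ENNReal RealInnerProductSpace

theorem inv_sqrt_mul_inv_sqrt (n : ℕ) : (√(n : ℝ))⁻¹ * (√(n : ℝ))⁻¹ = (n : ℝ)⁻¹ := by
  rw [← mul_inv, Real.mul_self_sqrt (Nat.cast_nonneg n)]

theorem sample_covariance_eq {n : ℕ} (hn : 0 < n) (x y : ℕ → ℝ) (u v : ℝ) :
    (n : ℝ)⁻¹ * ∑ i ∈ range n, (x i - (n : ℝ)⁻¹ * ∑ i ∈ range n, x i)
        * (y i - (n : ℝ)⁻¹ * ∑ i ∈ range n, y i)
      = (n : ℝ)⁻¹ * ∑ i ∈ range n, (x i - u) * (y i - v)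
        - ((n : ℝ)⁻¹ * ∑ i ∈ range n, x i - u) * ((n : ℝ)⁻¹ * ∑ i ∈ range n, y i - v) := by
  have hn0 : (n : ℝ) ≠ 0 := Nat.cast_ne_zero.2 hn.ne'
  set A := (n : ℝ)⁻¹ * ∑ i ∈ range n, x i with hA
  set B := (n : ℝ)⁻¹ * ∑ i ∈ range n, y i with hB
  have hA' : ∑ i ∈ range n, x i = n * A := by rw [hA, mul_inv_cancel_left₀ hn0]
  have hB' : ∑ i ∈ range n, y i = n * B := by rw [hB, mul_inv_cancel_left₀ hn0]
  have key : ∀ c d : ℝ, ∑ i ∈ range n, (x i - c) * (y i - d)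
      = ∑ i ∈ range n, x i * y i - c * (n * B) - d * (n * A) + n * (c * d) := by
    intro c d
    have h1 : ∀ i, (x i - c) * (y i - d) = x i * y i - c * y i - d * x i + c * d :=
      fun i => by ring
    rw [sum_congr rfl fun i _ => h1 i, sum_add_distrib, sum_sub_distrib, sum_sub_distrib,
      ← mul_sum, ← mul_sum, hA', hB', sum_const, card_range, nsmul_eq_mul]
  rw [key, key]
  field_simp
  ring

theorem yBar_sub {Ω : Type*} {Ys : ℕ → Ω → ℝ} {n : ℕ} {ω : Ω} (hn : 0 < n) (e : ℝ) :
    yBar Ys n ω - e = (√(n : ℝ))⁻¹ * ((√(n : ℝ))⁻¹ * ∑ i ∈ range n, (Ys i ω - e)) := by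
  have hn0 : (n : ℝ) ≠ 0 := Nat.cast_ne_zero.2 hn.ne'
  rw [← mul_assoc, inv_sqrt_mul_inv_sqrt, sum_sub_distrib, mul_sub, yBar, sum_const, card_range,
    nsmul_eq_mul, inv_mul_cancel_left₀ hn0]

variable {T Ω : Type*} [MeasurableSpace Ω] {P : Measure Ω}
variable {X : Ω → T → ℝ} {Y : Ω → ℝ} {b : T → ℝ}
variable {Xs : ℕ → Ω → T → ℝ} {Ys : ℕ → Ω → ℝ} {n : ℕ} {ω : Ω}

theorem xBar_sub_meanFun (hn : 0 < n) (t : T) : xBar Xs n ω t - meanFun P X t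
    = (√(n : ℝ))⁻¹ * ((√(n : ℝ))⁻¹ * ∑ i ∈ range n, (Xs i ω t - meanFun P X t)) := by
  have hn0 : (n : ℝ) ≠ 0 := Nat.cast_ne_zero.2 hn.ne'
  rw [← mul_assoc, inv_sqrt_mul_inv_sqrt, sum_sub_distrib, mul_sub, xBar, sum_const, card_range,
    nsmul_eq_mul, inv_mul_cancel_left₀ hn0]

theorem covHat_eq (hident : ∀ i, IdentDistrib (fun ω => (Xs i ω, Ys i ω))
    (fun ω => (X ω, Y ω)) P P) (hn : 0 < n) (s t : T) :
    covHat Xs n ω s t = covFun P X s t + (√(n : ℝ))⁻¹ * xi P X Xs n ω s t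
      - (xBar Xs n ω s - meanFun P X s) * (xBar Xs n ω t - meanFun P X t) := by
  have hn0 : (n : ℝ) ≠ 0 := Nat.cast_ne_zero.2 hn.ne'
  have h1 : ∀ i, ∫ ω', (Xs i ω' s - meanFun P X s) * (Xs i ω' t - meanFun P X t) ∂P
      = covFun P X s t := fun i =>
    (identDistrib_apply hident (measurable_centered_mul (meanFun P X) (s, t)) i).integral_eq
  have h2 := sample_covariance_eq hn (fun i => Xs i ω s) (fun i => Xs i ω t) (meanFun P X s)
    (meanFun P X t)
  simp only [covHat, xi, h1]
  rw [← mul_assoc, inv_sqrt_mul_inv_sqrt, sum_sub_distrib, mul_sub, sum_const, card_range,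
    nsmul_eq_mul, inv_mul_cancel_left₀ hn0]
  simp only [xBar] at h2 ⊢
  rw [h2]
  ring

theorem KbHat_eq (hident : ∀ i, IdentDistrib (fun ω => (Xs i ω, Ys i ω))
    (fun ω => (X ω, Y ω)) P P) (hn : 0 < n) (t : T) :
    KbHat Xs Ys n ω t = ∫ ω, centered P X ω t * (Y ω - ∫ ω', Y ω' ∂P) ∂P
      + (√(n : ℝ))⁻¹ * xiZero P X Xs Ys n ω t
      - (xBar Xs n ω t - meanFun P X t) * (yBar Ys n ω - ∫ ω', Y ω' ∂P) := by
  have hn0 : (n : ℝ) ≠ 0 := Nat.cast_ne_zero.2 hn.ne'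
  have h1 : ∀ i, ∫ ω', (Xs i ω' t - meanFun P X t) * (Ys i ω' - ∫ ω', Y ω' ∂P) ∂P
      = ∫ ω, centered P X ω t * (Y ω - ∫ ω', Y ω' ∂P) ∂P := fun i =>
    (identDistrib_apply hident
      (measurable_centered_mul_response (meanFun P X) (∫ ω', Y ω' ∂P) t) i).integral_eq
  have h2 := sample_covariance_eq hn (fun i => Xs i ω t) (fun i => Ys i ω) (meanFun P X t)
    (∫ ω', Y ω' ∂P)
  simp only [KbHat, xiZero, integral_response_eq hident, h1]
  rw [← mul_assoc, inv_sqrt_mul_inv_sqrt, sum_sub_distrib, mul_sub, sum_const, card_range,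
    nsmul_eq_mul, inv_mul_cancel_left₀ hn0]
  simp only [xBar, yBar] at h2 ⊢
  rw [h2]
  ring

variable [MeasureSpace T]

/-- The perturbation `D` of `L²` describes the sample `ω`: the functions `K^j(b)`, their
estimators and `ξ_j` are versions of its vectors. These functions are used for `j ≥ 1` only, so
the sequences of `D` start with index `0` at `j = 1`. -/
structure Represents (D : KrylovPerturbation (L2 T)) (P : Measure Ω) (X : Ω → T → ℝ) (b : T → ℝ)
    (Xs : ℕ → Ω → T → ℝ) (Ys : ℕ → Ω → ℝ) (n : ℕ) (ω : Ω) : Prop where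
  base (j : ℕ) : Kpow P X b (j + 1) =ᵐ[volume] D.base j
  pert (j : ℕ) : KpowHat Xs Ys n ω (j + 1) =ᵐ[volume] D.pert j
  first (j : ℕ) : xiSeq P X b Xs Ys n ω (j + 1) =ᵐ[volume] D.first j
  m : (fun t => xBar Xs n ω t - meanFun P X t) =ᵐ[volume] D.m
  s : D.s = (√(n : ℝ))⁻¹

theorem memLp_of_ae_eq {f : T → ℝ} {F : L2 T} (h : f =ᵐ[volume] F) : MemLp f 2 volume :=
  (Lp.memLp F).ae_eq h.symm

/-- The recursion of `first`, solved: the formula by which `ξ_j` is defined. -/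
theorem first_eq_sum {E : Type*} [NormedAddCommGroup E] [InnerProductSpace ℝ E]
    (D : KrylovPerturbation E) (j : ℕ) :
    D.first j = D.K^[j] D.ξ₀ + ∑ k ∈ range j, D.K^[k] (D.Ξ (D.base (j - k - 1))) := by
  induction j with
  | zero => simp [KrylovPerturbation.first]
  | succ j ih =>
    rw [KrylovPerturbation.first, ih, map_add, map_sum, ← Function.iterate_succ_apply' (⇑D.K),
      sum_range_succ' _ j, add_assoc]
    simp only [← Function.iterate_succ_apply' (⇑D.K), Function.iterate_zero, id, Nat.sub_zero,
      Nat.add_sub_cancel, Nat.add_sub_add_right]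

variable [SFinite (volume : Measure T)] [IsProbabilityMeasure P] {ε : Ω → ℝ} {a : ℝ}

/-- On the event `GoodSample`, a sample is a small perturbation of the population. -/
theorem GoodSample.exists_represents (hX : Measurable fun q : Ω × T => X q.1 q.2)
    (hX4 : ∫⁻ ω, eLpNorm (X ω) 2 volume ^ 4 ∂P < ∞) (hb : MemLp b 2 volume)
    (hmodel : ∀ᵐ ω ∂P, Y ω = a + (∫ t, b t * X ω t) + ε ω) (hε : MemLp ε 2 P)
    (hcond : P[ε | MeasurableSpace.comap X inferInstance] =ᵐ[P] 0)
    (hXs : ∀ i, Measurable fun q : Ω × T => Xs i q.1 q.2)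
    (hident : ∀ i, IdentDistrib (fun ω => (Xs i ω, Ys i ω)) (fun ω => (X ω, Y ω)) P P)
    {M κ : ℝ} (hM : 0 < M) (h : GoodSample P X Y Xs Ys M n ω) (hn : 0 < n)
    (hκ : kerNorm (covFun P X) ≤ κ)
    (hsmall : κ + (M + M ^ 2) * (√(n : ℝ))⁻¹ ≤ (1 + κ) / 2) :
    ∃ D : KrylovPerturbation (L2 T), D.Bounded κ M (eLpNorm (Kpow P X b 1) 2 volume).toReal ∧
      Represents D P X b Xs Ys n ω := by
  have hcov := memLp_covFun (P := P) hX hX4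
  have hμ := measurable_meanFun (P := P) hX
  have hXω : ∀ i, Measurable (Xs i ω) := fun i => (hXs i).comp measurable_prodMk_left
  have hn1 : (1 : ℝ) ≤ n := Nat.one_le_cast.2 hn
  have hsq : 0 < √(n : ℝ) := Real.sqrt_pos.2 (by linarith)
  have hs0 : 0 < (√(n : ℝ))⁻¹ := inv_pos.2 hsq
  have hs1 : (√(n : ℝ))⁻¹ ≤ 1 := inv_le_one_of_one_le₀ (Real.one_le_sqrt.2 hn1)
  have hxi : MemLp (Function.uncurry (xi P X Xs n ω)) 2 (volume.prod volume) := by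
    refine ⟨?_, h.xi_le.trans_lt ENNReal.ofReal_lt_top⟩
    have hmix : ∀ i, Measurable fun q : T × T =>
        ∫ ω', (Xs i ω' q.1 - meanFun P X q.1) * (Xs i ω' q.2 - meanFun P X q.2) ∂P := by
      intro i
      have h1 : ∀ q : T × T,
          ∫ ω', (Xs i ω' q.1 - meanFun P X q.1) * (Xs i ω' q.2 - meanFun P X q.2) ∂P
          = covFun P X q.1 q.2 := fun q =>
        (identDistrib_apply hident (measurable_centered_mul (meanFun P X) q) i).integral_eq
      simp only [h1]
      exact measurable_covFun hX
    refine Measurable.aestronglyMeasurable ?_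
    refine Measurable.const_mul ?_ _
    refine Finset.measurable_fun_sum _ fun i _ => ?_
    exact ((((hXω i).sub hμ).comp measurable_fst).mul
      (((hXω i).sub hμ).comp measurable_snd)).sub (hmix i)
  have hv : MemLp (Kpow P X b 1) 2 volume := memLp_Kpow hX hX4 hb 1
  have hm : MemLp (fun t => xBar Xs n ω t - meanFun P X t) 2 volume :=
    ((memLp_finsetSum _ fun i _ => h.memLp i).const_mul _).sub (memLp_meanFun hX hX4)
  have hC := integral_centered_mul_response hX hX4 hb hmodel hε hcond
  have hKb : KbHat Xs Ys n ω =ᵐ[volume] fun t => Kpow P X b 1 t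
      + (√(n : ℝ))⁻¹ * xiZero P X Xs Ys n ω t
      - (yBar Ys n ω - ∫ ω', Y ω' ∂P) * (xBar Xs n ω t - meanFun P X t) := by
    filter_upwards [hC] with t ht
    rw [KbHat_eq hident hn, ht, mul_comm (xBar Xs n ω t - meanFun P X t)]
    rfl
  -- by `hKb`, `ξ₀` is almost everywhere a linear combination of square-integrable functions
  have hxi0 : MemLp (xiZero P X Xs Ys n ω) 2 volume := by
    have hKbL : MemLp (KbHat Xs Ys n ω) 2 volume :=
      (memLp_finsetSum _ fun i _ => (memLp_sub_xBar h.memLp i).mul_const _).const_mul _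
    have h1 := ((hKbL.sub hv).add (hm.const_mul (yBar Ys n ω - ∫ ω', Y ω' ∂P))).const_mul
      (√(n : ℝ))
    refine h1.ae_eq ?_
    filter_upwards [hKb] with t ht
    simp only [Pi.add_apply, Pi.sub_apply, ht]
    field_simp
    ring
  set D : KrylovPerturbation (L2 T) :=
    { K := kerCLM (covFun P X) hcov
      Ξ := kerCLM (xi P X Xs n ω) hxi
      v := hv.toLp
      ξ₀ := hxi0.toLp
      m := hm.toLp
      y := yBar Ys n ω - ∫ ω', Y ω' ∂P
      s := (√(n : ℝ))⁻¹ } with hD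
  have rm : (fun t => xBar Xs n ω t - meanFun P X t) =ᵐ[volume] D.m := hm.coeFn_toLp.symm
  have rbase : ∀ j, Kpow P X b (j + 1) =ᵐ[volume] D.base j := fun j => by
    have e1 : Kpow P X b (j + 1) = (kerOp (covFun P X))^[j] (Kpow P X b 1) :=
      Function.iterate_add_apply _ j 1 b
    rw [e1]
    exact kerOp_iterate_ae_eq hcov (hv.coeFn_toLp.symm) j
  have rop : ∀ {f : T → ℝ} {F : L2 T}, f =ᵐ[volume] F →
      kerOp (covHat Xs n ω) f =ᵐ[volume] D.pertOp F := by
    intro f F hf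
    have hfL := memLp_of_ae_eq hf
    have e1 := kerOp_ae_eq hcov hf
    have e2 := kerOp_ae_eq hxi hf
    rw [KrylovPerturbation.pertOp_apply]
    have hin : ⟪D.m, F⟫ = ∫ s, (xBar Xs n ω s - meanFun P X s) * f s :=
      (integral_mul_eq_inner rm hf).symm
    filter_upwards [e1, e2, rm, ae_memLp_section hcov, ae_memLp_section hxi,
      Lp.coeFn_sub (D.K F + D.s • D.Ξ F) (⟪D.m, F⟫ • D.m), Lp.coeFn_add (D.K F) (D.s • D.Ξ F),
      Lp.coeFn_smul D.s (D.Ξ F), Lp.coeFn_smul ⟪D.m, F⟫ D.m]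
      with t h1 h2 h3 h4 h5 h6 h7 h8 h9
    rw [h6, Pi.sub_apply, h7, Pi.add_apply, h8, h9, Pi.smul_apply, Pi.smul_apply, ← h3, ← h1,
      ← h2, hin, smul_eq_mul, smul_eq_mul]
    have i1 := integrable_fun_mul hfL h4
    have i2 := (integrable_fun_mul hfL h5).const_mul (√(n : ℝ))⁻¹
    have i3 := (integrable_fun_mul hm hfL).mul_const (xBar Xs n ω t - meanFun P X t)
    have i12 : Integrable (fun s => f s * covFun P X s t
      + (√(n : ℝ))⁻¹ * (f s * xi P X Xs n ω s t)) volume := i1.add i2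
    have e3 : kerOp (covHat Xs n ω) f t = ∫ s, (f s * covFun P X s t
        + (√(n : ℝ))⁻¹ * (f s * xi P X Xs n ω s t)
        - (xBar Xs n ω s - meanFun P X s) * f s * (xBar Xs n ω t - meanFun P X t)) := by
      refine integral_congr_ae (ae_of_all _ fun s => ?_)
      simp only [covHat_eq hident hn]
      ring
    rw [e3, integral_sub i12 i3, integral_add i1 i2, integral_const_mul, integral_mul_const]
    rfl
  have rpert : ∀ j, KpowHat Xs Ys n ω (j + 1) =ᵐ[volume] D.pert j := by
    intro j
    induction j with
    | zero =>
      have e0 : D.pert 0 = D.v + D.s • D.ξ₀ - D.y • D.m := rfl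
      have e1 : KpowHat Xs Ys n ω (0 + 1) = KbHat Xs Ys n ω := rfl
      rw [e0, e1]
      filter_upwards [hKb, hv.coeFn_toLp, hxi0.coeFn_toLp, hm.coeFn_toLp,
        Lp.coeFn_sub (D.v + D.s • D.ξ₀) (D.y • D.m), Lp.coeFn_add D.v (D.s • D.ξ₀),
        Lp.coeFn_smul D.s D.ξ₀, Lp.coeFn_smul D.y D.m] with t h1 h2 h3 h4 h5 h6 h7 h8
      rw [h1, h5, Pi.sub_apply, h6, Pi.add_apply, h7, h8, Pi.smul_apply, Pi.smul_apply,
        smul_eq_mul, smul_eq_mul]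
      simp only [hD]
      rw [h2, h3, h4]
    | succ j ih =>
      rw [KpowHat_succ, KrylovPerturbation.pert_succ]
      exact rop ih
  have rfirst : ∀ j, xiSeq P X b Xs Ys n ω (j + 1) =ᵐ[volume] D.first j := by
    intro j
    rw [first_eq_sum]
    have e1 := kerOp_iterate_ae_eq hcov (hxi0.coeFn_toLp.symm) j
    have e2 : ∀ᵐ t, ∀ k ∈ range j,
        (kerOp (covFun P X))^[k] (zeta P X b Xs n ω (j + 1 - k - 1)) t
          = (D.K^[k] (D.Ξ (D.base (j - k - 1))) : L2 T) t := by
      rw [eventually_all_finset]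
      intro k hk
      have hk' : j + 1 - k - 1 = (j - k - 1) + 1 := by
        have := mem_range.1 hk
        omega
      rw [hk']
      exact kerOp_iterate_ae_eq hcov (kerOp_ae_eq hxi (rbase (j - k - 1))) k
    filter_upwards [e1, e2, Lp.coeFn_add (D.K^[j] D.ξ₀)
      (∑ k ∈ range j, D.K^[k] (D.Ξ (D.base (j - k - 1)))),
      Lp.coeFn_finsetSum (range j) (fun k => D.K^[k] (D.Ξ (D.base (j - k - 1))))]
      with t h1 h2 h3 h4
    rw [h3, Pi.add_apply, h4, xiSeq, Nat.add_sub_cancel, h1, sum_congr rfl h2, Finset.sum_apply]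
  refine ⟨D, ⟨?_, ?_, ?_, ?_, ?_, ?_, hs0, hs1, hsmall⟩, ⟨rbase, rpert, rfirst, rm, rfl⟩⟩
  · exact (norm_kerCLM_le hcov).trans ((kerNorm_eq hcov).symm.le.trans hκ)
  · exact (Lp.norm_toLp (Kpow P X b 1) hv).le
  · exact (norm_kerCLM_le hxi).trans (ENNReal.toReal_le_of_le_ofReal hM.le h.xi_le)
  · exact (Lp.norm_toLp (xiZero P X Xs Ys n ω) hxi0).le.trans
      (ENNReal.toReal_le_of_le_ofReal hM.le h.xiZero_le)
  · have e1 : (fun t => xBar Xs n ω t - meanFun P X t) = (√(n : ℝ))⁻¹ • fun t =>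
        (√(n : ℝ))⁻¹ * ∑ i ∈ range n, (Xs i ω t - meanFun P X t) := by
      funext t
      exact xBar_sub_meanFun hn t
    refine (Lp.norm_toLp _ hm).le.trans ?_
    rw [e1, eLpNorm_const_smul, ENNReal.toReal_mul, toReal_enorm, Real.norm_of_nonneg hs0.le,
      mul_comm]
    exact mul_le_mul_of_nonneg_right (ENNReal.toReal_le_of_le_ofReal hM.le h.mean_le) hs0.le
  · show |yBar Ys n ω - ∫ ω', Y ω' ∂P| ≤ M * (√(n : ℝ))⁻¹
    rw [yBar_sub hn, abs_mul, abs_of_pos hs0, mul_comm]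
    refine mul_le_mul_of_nonneg_right ?_ hs0.le
    have := ENNReal.toReal_le_of_le_ofReal hM.le h.response_le
    rwa [toReal_enorm, Real.norm_eq_abs] at this

end Bridge

/-! ### Uniform first-order expansions -/

section Uniform

open Matrix Topology
open scoped ENNReal RealInnerProductSpace

variable {T : Type*} [MeasureSpace T]
variable {Ω : Type*} [MeasurableSpace Ω] {P : Measure Ω}
variable {X : Ω → T → ℝ} {Y : Ω → ℝ} {b : T → ℝ}
variable {Xs : ℕ → Ω → T → ℝ} {Ys : ℕ → Ω → ℝ} {n : ℕ} {ω : Ω} {D : KrylovPerturbation (L2 T)}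

theorem Represents.Hmat_eq (h : Represents D P X b Xs Ys n ω) (p : ℕ) :
    Hmat P X b p = gram D.base p := by
  ext j k
  exact integral_mul_eq_inner (h.base (j + 1)) (h.base k)

theorem Represents.gramVec_base (h : Represents D P X b Xs Ys n ω) (p : ℕ) :
    (fun k : Fin p => ∫ t, Kpow P X b 1 t * Kpow P X b (k + 1) t) = gramVec D.base p := by
  ext k
  exact integral_mul_eq_inner (h.base 0) (h.base k)

theorem Represents.gram_pert (h : Represents D P X b Xs Ys n ω) (p : ℕ) :
    (Matrix.of fun j k : Fin p =>
      ∫ t, KpowHat Xs Ys n ω (j + 2) t * KpowHat Xs Ys n ω (k + 1) t) = gram D.pert p := by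
  ext j k
  exact integral_mul_eq_inner (h.pert (j + 1)) (h.pert k)

theorem Represents.gramVec_pert (h : Represents D P X b Xs Ys n ω) (p : ℕ) :
    (fun k : Fin p => ∫ t, KpowHat Xs Ys n ω 1 t * KpowHat Xs Ys n ω (k + 1) t)
      = gramVec D.pert p := by
  ext k
  exact integral_mul_eq_inner (h.pert 0) (h.pert k)

theorem Represents.DeltaOneEntry_eq (h : Represents D P X b Xs Ys n ω) (j k : ℕ) :
    DeltaOneEntry P X b Xs Ys n ω j (k + 1)
      = ⟪D.first j, D.base k⟫ + ⟪D.base j, D.first k⟫ := by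
  rw [DeltaOneEntry, integral_add
    (integrable_fun_mul (memLp_of_ae_eq (h.first j)) (memLp_of_ae_eq (h.base k)))
    (integrable_fun_mul (memLp_of_ae_eq (h.base j)) (memLp_of_ae_eq (h.first k))),
    integral_mul_eq_inner (h.first j) (h.base k), integral_mul_eq_inner (h.base j) (h.first k)]

theorem Represents.DeltaOne_eq (h : Represents D P X b Xs Ys n ω) (p : ℕ) :
    DeltaOne P X b Xs Ys n ω p = gramDeriv D.base D.first p := by
  ext j k
  exact h.DeltaOneEntry_eq (j + 1) k

theorem Represents.deltaVec_eq (h : Represents D P X b Xs Ys n ω) (p : ℕ) :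
    deltaVec P X b Xs Ys n ω p = gramVecDeriv D.base D.first p := by
  ext k
  exact h.DeltaOneEntry_eq 0 k

/-- The remainder of the expansion of the predictor, in terms of vectors of `L²`. -/
theorem Represents.remainder_eq (h : Represents D P X b Xs Ys n ω) (p : ℕ) {x : T → ℝ}
    {z : L2 T} (hz : (fun t => x t - meanFun P X t) =ᵐ[volume] z) :
    gpHat Xs Ys n ω p x - gp P X Y b p x - expansion P X b Xs Ys n ω Y p x
      = ∑ j, gamHat Xs Ys n ω p j * ⟪z - D.m, D.pert j⟫ - ∑ j, gam P X b p j * ⟪z, D.base j⟫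
        - D.s * ∑ j, (corr P X b Xs Ys n ω p j * ⟪z, D.base j⟫
          + gam P X b p j * (⟪z, D.first j⟫ - D.s⁻¹ * ⟪D.m, D.base j⟫)) := by
  have hx : (fun t => x t - xBar Xs n ω t) =ᵐ[volume] (z - D.m : L2 T) := by
    filter_upwards [hz, h.m, Lp.coeFn_sub z D.m] with t h1 h2 h3
    rw [h3, Pi.sub_apply, ← h1, ← h2]
    ring
  have e1 : ∀ j, ∫ t, (x t - xBar Xs n ω t) * KpowHat Xs Ys n ω (j + 1) t
      = ⟪z - D.m, D.pert j⟫ := fun j => integral_mul_eq_inner hx (h.pert j)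
  have e2 : ∀ j, ∫ t, (x t - meanFun P X t) * Kpow P X b (j + 1) t = ⟪z, D.base j⟫ :=
    fun j => integral_mul_eq_inner hz (h.base j)
  have e3 : ∀ j, ∫ t, ((x t - meanFun P X t) * xiSeq P X b Xs Ys n ω (j + 1) t
      - √(n : ℝ) * (xBar Xs n ω t - meanFun P X t) * Kpow P X b (j + 1) t)
      = ⟪z, D.first j⟫ - D.s⁻¹ * ⟪D.m, D.base j⟫ := by
    intro j
    have i1 := integrable_fun_mul (memLp_of_ae_eq hz) (memLp_of_ae_eq (h.first j))
    have i2 := (integrable_fun_mul (memLp_of_ae_eq h.m) (memLp_of_ae_eq (h.base j))).const_mul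
      √(n : ℝ)
    simp only [mul_assoc]
    rw [integral_sub i1 i2, integral_const_mul, integral_mul_eq_inner hz (h.first j),
      integral_mul_eq_inner h.m (h.base j), h.s, inv_inv]
  simp only [gpHat, gp, expansion, e1, e2, e3, h.s]
  ring

variable [SFinite (volume : Measure T)] [IsProbabilityMeasure P] {ε : Ω → ℝ} {a : ℝ}

/-- Outside an event of small probability, the two expansions hold for all admissible `p` and all
`x` in a ball at once. -/
theorem exists_uniform_expansion (hX : Measurable fun q : Ω × T => X q.1 q.2)
    (hX4 : ∫⁻ ω, eLpNorm (X ω) 2 volume ^ 4 ∂P < ∞) (hb : MemLp b 2 volume)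
    (hmodel : ∀ᵐ ω ∂P, Y ω = a + (∫ t, b t * X ω t) + ε ω) (hε : MemLp ε 2 P)
    (hcond : P[ε | MeasurableSpace.comap X inferInstance] =ᵐ[P] 0)
    (hεX : ∫⁻ ω, ‖ε ω‖ₑ ^ 2 * eLpNorm (X ω) 2 volume ^ 2 ∂P < ∞)
    (hXs : ∀ i, Measurable fun q : Ω × T => Xs i q.1 q.2)
    (hindep : iIndepFun (fun i ω => (Xs i ω, Ys i ω)) P)
    (hident : ∀ i, IdentDistrib (fun ω => (Xs i ω, Ys i ω)) (fun ω => (X ω, Y ω)) P P)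
    (hK : kerNorm (covFun P X) < 1) {C : ℝ} (hC : 0 < C) {ρ : ℕ → ℝ}
    (hρ : Tendsto ρ atTop atTop) {η : ℝ} (hη : 0 < η) :
    ∃ (M₁ M₂ : ℝ) (N : ℕ) (G : ℕ → Set Ω), ∀ n ≥ N, P (G n)ᶜ ≤ ENNReal.ofReal η ∧
      ∀ ω ∈ G n, ∀ p ∈ admissible P X b C ρ n,
        vecNorm (gamHat Xs Ys n ω p
          - (gam P X b p + (√(n : ℝ))⁻¹ • corr P X b Xs Ys n ω p))
          ≤ M₁ * ((n : ℝ)⁻¹ * (lam P X b p)⁻¹ ^ 3) ∧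
        ∀ x, MemLp x 2 volume → eLpNorm x 2 volume ≤ ENNReal.ofReal C →
          |gpHat Xs Ys n ω p x - gp P X Y b p x - expansion P X b Xs Ys n ω Y p x|
            ≤ M₂ * ((n : ℝ)⁻¹ * (lam P X b p)⁻¹ * vecNorm (gam P X b p)
              + (n : ℝ)⁻¹ * (lam P X b p)⁻¹ ^ 3) := by
  obtain ⟨M, hM, hgood⟩ :=
    exists_goodSample hX hX4 hb hmodel hε hcond hεX hXs hindep hident hη
  set κ := kerNorm (covFun P X) with hκ
  obtain ⟨B, hB, hsum⟩ := KrylovPerturbation.Bounded.exists_sumBounds (E := L2 T) hK M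
    (eLpNorm (Kpow P X b 1) 2 volume).toReal
  have hμ := memLp_meanFun (P := P) hX hX4
  set Z := C + (eLpNorm (meanFun P X) 2 volume).toReal with hZ
  have hZ0 : 0 ≤ Z := by positivity
  have hsqrt : Tendsto (fun n : ℕ => κ + (M + M ^ 2) * (√(n : ℝ))⁻¹) atTop
      (𝓝 (κ + (M + M ^ 2) * 0)) :=
    ((tendsto_inv_atTop_zero.comp
      (Real.tendsto_sqrt_atTop.comp tendsto_natCast_atTop_atTop)).const_mul _).const_add _
  have hev := (hsqrt.eventually_le_const (u := (1 + κ) / 2) (by linarith)).and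
    ((hρ.eventually_ge_atTop (6 * B ^ 2)).and (eventually_gt_atTop 0))
  obtain ⟨N, hN⟩ := eventually_atTop.1 hev
  refine ⟨6 * (3 * B ^ 2) ^ 3, B * (3 * B ^ 2) ^ 3 * (11 * Z + 9 * M), N,
    fun n => {ω | GoodSample P X Y Xs Ys M n ω}, fun n hn => ⟨hgood n, fun ω hω p hp => ?_⟩⟩
  obtain ⟨hsmall, hρn, hn0⟩ := hN n hn
  obtain ⟨hp1, -, hpl⟩ := hp
  obtain ⟨D, hD, hrep⟩ := hω.exists_represents hX hX4 hb hmodel hε hcond hXs hident hM hn0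
    le_rfl hsmall
  have hS := hsum D hD
  have hn1 : (0 : ℝ) < n := Nat.cast_pos.2 hn0
  have hsq : 0 < √(n : ℝ) := Real.sqrt_pos.2 hn1
  have hs2 : D.s ^ 2 = (n : ℝ)⁻¹ := by rw [hrep.s, pow_two, inv_sqrt_mul_inv_sqrt]
  have hl : 0 < lam P X b p := by
    have : 0 < √(n : ℝ) * lam P X b p := by
      have : 0 < 6 * B ^ 2 := by positivity
      linarith
    exact pos_of_mul_pos_right this hsq.le
  have hH : Coercive (gram D.base p) (lam P X b p) := by
    rw [← hrep.Hmat_eq]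
    exact coercive_Hmat hX hX4 hb p
  have hsl : 3 * B ^ 2 * D.s ≤ lam P X b p / 2 := by
    rw [hrep.s, ← div_eq_mul_inv, div_le_iff₀ hsq]
    linarith
  have hγ : gram D.base p *ᵥ gam P X b p = gramVec D.base p := by
    rw [← hrep.Hmat_eq, ← hrep.gramVec_base]
    exact Hmat_mulVec_gam hX hX4 hb hl
  have hγh : gram D.pert p *ᵥ gamHat Xs Ys n ω p = gramVec D.pert p := by
    have h1 := hH.perturb ((hS.gram_sub hB).trans hsl)
    rw [add_sub_cancel, ← hrep.gram_pert] at h1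
    rw [← hrep.gram_pert, ← hrep.gramVec_pert]
    exact mulVec_gamHat hω.memLp (fun j => memLp_of_ae_eq (hrep.pert j)) (half_pos hl) h1
  have hc : gram D.base p *ᵥ corr P X b Xs Ys n ω p
      = gramVecDeriv D.base D.first p - gramDeriv D.base D.first p *ᵥ gam P X b p := by
    rw [corr, hrep.Hmat_eq, hrep.deltaVec_eq, hrep.DeltaOne_eq, mulVec_mulVec,
      mul_nonsing_inv _ (hH.isUnit_det hl), one_mulVec]
  refine ⟨?_, fun x hx hxC => ?_⟩
  · have := (hS.coefficients hB hp1 hl hH hsl hγ hγh hc).2.2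
    rwa [hs2, hrep.s, mul_assoc] at this
  · have hxμ : MemLp (fun t => x t - meanFun P X t) 2 volume := hx.sub hμ
    have hz : ‖hxμ.toLp‖ ≤ Z := by
      rw [Lp.norm_toLp]
      have h1 : eLpNorm (fun t => x t - meanFun P X t) 2 volume
          ≤ ENNReal.ofReal C + eLpNorm (meanFun P X) 2 volume :=
        (eLpNorm_sub_le hx.aestronglyMeasurable hμ.aestronglyMeasurable (by norm_num)).trans
          (add_le_add_left hxC _)
      refine (ENNReal.toReal_mono (ENNReal.add_ne_top.2
        ⟨ENNReal.ofReal_ne_top, hμ.eLpNorm_ne_top⟩) h1).trans (le_of_eq ?_)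
      rw [ENNReal.toReal_add ENNReal.ofReal_ne_top hμ.eLpNorm_ne_top, ENNReal.toReal_ofReal hC.le]
    rw [hrep.remainder_eq p hxμ.coeFn_toLp.symm]
    refine (hS.prediction hB hp1 hl hH hsl hγ hγh hc hz hM.le).trans ?_
    rw [hs2, mul_assoc]
    refine mul_le_mul_of_nonneg_left ?_ (by positivity)
    have h0 := vecNorm_nonneg (gam P X b p)
    have : 0 ≤ (n : ℝ)⁻¹ * (lam P X b p)⁻¹ * vecNorm (gam P X b p) := by positivity
    linarith

theorem isFiniteMeasure_volume_Icc (c d : ℝ) :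
    IsFiniteMeasure (volume : Measure (Set.Icc c d)) := by
  refine ⟨?_⟩
  rw [Measure.Subtype.volume_univ measurableSet_Icc.nullMeasurableSet]
  exact measure_Icc_lt_top

end Uniform

end APLS

theorem theorem5p3 {Ω : Type*} [MeasurableSpace Ω] (P : Measure Ω) [IsProbabilityMeasure P]
    -- the compact interval on which the random functions live
    (c d : ℝ) (hcd : c < d)
    -- the functional linear model
    (X : Ω → Set.Icc c d → ℝ) (Y ε : Ω → ℝ) (a : ℝ) (b : Set.Icc c d → ℝ)
    (hX : Measurable fun q : Ω × Set.Icc c d => X q.1 q.2)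
    (hmodel : ∀ᵐ ω ∂P, Y ω = a + (∫ t, b t * X ω t) + ε ω)
    (hcond : P[ε | MeasurableSpace.comap X inferInstance] =ᵐ[P] 0)
    -- moment conditions
    (hb : MemLp b 2 volume)
    (hX4 : ∫⁻ ω, eLpNorm (X ω) 2 volume ^ 4 ∂P < ⊤)
    (hε : MemLp ε 2 P)
    (hεX : ∫⁻ ω, ‖ε ω‖ₑ ^ 2 * eLpNorm (X ω) 2 volume ^ 2 ∂P < ⊤)
    -- the sample: independent pairs, all distributed as `(X, Y)`
    (Xs : ℕ → Ω → Set.Icc c d → ℝ) (Ys : ℕ → Ω → ℝ)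
    (hXs : ∀ i, Measurable fun q : Ω × Set.Icc c d => Xs i q.1 q.2)
    (hindep : iIndepFun (fun i ω => (Xs i ω, Ys i ω)) P)
    (hident : ∀ i, IdentDistrib (fun ω => (Xs i ω, Ys i ω)) (fun ω => (X ω, Y ω)) P P)
    -- the spectral decomposition of the covariance transformation
    (φ : HilbertBasis ℕ ℝ (Lp ℝ 2 (volume : Measure (Set.Icc c d)))) (θ : ℕ → ℝ)
    (hφ : ∀ k, APLS.kerOp (APLS.covFun P X) (φ k) =ᵐ[volume] fun t => θ k * φ k t)
    (hθanti : Antitone θ) (hθpos : ∀ k, 0 < θ k)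
    (hθK : θ 0 < APLS.kerNorm (APLS.covFun P X))
    (hK : APLS.kerNorm (APLS.covFun P X) < 1)
    -- the constant `C`, and a sequence `ρ n → ∞` bounding `n^{1/2} λ(p)` from below
    (C : ℝ) (hC : 0 < C) (ρ : ℕ → ℝ) (hρ : Tendsto ρ atTop atTop) :
    APLS.IsBigOpUniform P
      (fun n => APLS.admissible P X b C ρ n)
      (fun n p ω => APLS.vecNorm
        (APLS.gamHat Xs Ys n ω p
          - (APLS.gam P X b p + (√(n : ℝ))⁻¹ • APLS.corr P X b Xs Ys n ω p)))
      (fun n p => (n : ℝ)⁻¹ * (APLS.lam P X b p)⁻¹ ^ 3) ∧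
    APLS.IsBigOpUniform P
      (fun n => {q : ℕ × (Set.Icc c d → ℝ) | q.1 ∈ APLS.admissible P X b C ρ n ∧
        MemLp q.2 2 volume ∧ eLpNorm q.2 2 volume ≤ ENNReal.ofReal C})
      (fun n q ω => APLS.gpHat Xs Ys n ω q.1 q.2 - APLS.gp P X Y b q.1 q.2
        - APLS.expansion P X b Xs Ys n ω Y q.1 q.2)
      (fun n q => (n : ℝ)⁻¹ * (APLS.lam P X b q.1)⁻¹ * APLS.vecNorm (APLS.gam P X b q.1)
        + (n : ℝ)⁻¹ * (APLS.lam P X b q.1)⁻¹ ^ 3) := by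
  have := APLS.isFiniteMeasure_volume_Icc c d
  refine ⟨fun η hη => ?_, fun η hη => ?_⟩
  all_goals
    obtain ⟨M₁, M₂, N, G, hG⟩ := APLS.exists_uniform_expansion hX hX4 hb hmodel hε hcond hεX hXs
      hindep hident hK hC hρ hη
  · refine ⟨M₁, N, fun n hn => (measure_mono fun ω hω => ?_).trans (hG n hn).1⟩
    obtain ⟨p, hp, hlt⟩ := hω
    refine fun hωG => hlt.not_ge ?_
    rw [abs_of_nonneg (APLS.vecNorm_nonneg _)]
    exact ((hG n hn).2 ω hωG p hp).1
  · refine ⟨M₂, N, fun n hn => (measure_mono fun ω hω => ?_).trans (hG n hn).1⟩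
    obtain ⟨q, ⟨hp, hx, hxC⟩, hlt⟩ := hω
    exact fun hωG => hlt.not_ge (((hG n hn).2 ω hωG q.1 hp).2 q.2 hx hxC)
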